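/- Let $c\ge 1$ and $0\le r\le\infty$, where a $C^0$-diffeomorphism means a bi-Lipschitz homeomorphism, and let $\phi$ be a $C^r$-diffeomorphism of $\mathbb{R}^c$ with a hyperbolic fixed point $x$ of $s$-index $m$ (attracting if $m=c$, repelling if $m=0$, saddle if $0<m<c$). *Terminology.* For $\phi_1,\dots,\phi_k$ let $\Phi(\xi,y)=(\tau\xi,\phi_{\xi_0}(y))$ on $\{1,\dots,k\}^{\mathbb{Z}}\times\mathbb{R}^c$, with $\tau$ the left shift, and for $D\subset\mathbb R^c$ let $\Gamma=\bigcap_{n\in\mathbb{Z}}\Phi^n(\{1,\dots,k\}^{\mathbb{Z}}\times\overline{D})$. Bounded open sets $B$, $D$ with $\overline{B}\subset D$ are considered for which $\Gamma$ is a transitive hyperbolic set of $\Phi$; its $cs$-index is the dimension of the stable direction in the fibre $\mathbb R^c$, its $cu$-index that of the unstable one. $B$ is a $cs$-blending region with respect to $\{\phi_1,\dots,\phi_k\}$ on $D$ if moreover $\overline{B}\subset\bigcup_i\phi_i(B)$ and the $cs$-index is positive; a $cu$-blending region if moreover $\overline{B}\subset\bigcup_i\phi_i^{-1}(B)$ and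 the $cu$-index is positive; a double-blending region if both hold. The $cs$-index of the blending region is that of $\Gamma$. For $r\ge 1$, $x$ is hyperbolic of $s$-index $m$ if there is a $D\phi(x)$-invariant splitting $\mathbb{R}^c=E^s\oplus E^u$, $\dim E^s=m$, with $E^s$ exponentially contracted by the iterates of $D\phi(x)$ and $E^u$ exponentially contracted by those of its inverse; $\Gamma$ is hyperbolic if it is compact, $\Phi$-invariant and has such an invariant splitting of the fibre direction, with uniform constants and constant dimensions, under the derivatives of the fibre maps. For $r=0$ one requires instead, in the manner of the Conley–Moser conditions, a splitting $E^s\oplus E^u$ with adapted norms (depending on the point of $\Gamma$, with norms uniformly equivalent to the Euclidean one, in the case of $\Gamma$) such that near the point, uniformly, each map $y\mapsto y'$ is given in cross form $(y_s,y'_u)\mapsto(y'_s,y_u)$ by a contraction, for the maximum norm and with a rate $<1$, which is defined on a neighbourhood of fixed size. *Statement.* There exist an integer $k\ge 2$ (which does not depend on $\varepsilon$), arcs of $C^r$-diffeomorphisms $\phi_1(\varepsilon),\dots,\phi_k(\varepsilon)$ of $\mathbb{R}^c$ and bounded open sets $D(\varepsilon)$, $\varepsilon\ge 0$, and numbers $\delta(\varepsilon)$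 such that - $\phi_i(0)=\phi$ for $i=1,\dots,k$; - $\phi_i(\varepsilon)=T_i(\varepsilon)\circ\phi$, where $T_i(\varepsilon)$ is a translation by a vector depending continuously on $\varepsilon\ge 0$, and $\phi_1(\varepsilon)=\phi$ for all $\varepsilon\ge0$; - if, for some $0<\theta<1$, there are $\gamma,\hat\gamma\in(\theta,1)$ with $\gamma|y-z|\le|\phi(y)-\phi(z)|\le\hat\gamma^{-1}|y-z|$ for all $y,z$ (partial hyperbolicity of the skew-product, $\theta=\nu^\alpha$), then for every $\varepsilon\ge0$ there are such $\gamma,\hat\gamma$ valid for all the $\phi_i(\varepsilon)$, with the same $\theta$; - for every $\varepsilon>0$: $\delta(\varepsilon)>0$, $B:=B_{\delta(\varepsilon)}(x)\subset D(\varepsilon)\subset B_{2\varepsilon}(x)$, and $B$ is a $cs$-blending region (if $x$ is attracting), a $cu$-blending region (if $x$ is repelling), a double-blending region (if $x$ is a saddle) with respect to $\{\phi_1(\varepsilon),\dots,\phi_k(\varepsilon)\}$ on $D(\varepsilon)$, whose $cs$-index is $m$. -/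

import Mathlib

open Set Filter Topology

namespace Blending

/-- `ℝ^c` with its Euclidean norm. -/
abbrev E (c : ℕ) := EuclideanSpace ℝ (Fin c)

/-- `C^r`-diffeomorphisms of `ℝ^c`, `0 ≤ r ≤ ∞`; a `C^0`-diffeomorphism is a bi-Lipschitz
homeomorphism. -/
def IsCrDiffeo {c : ℕ} (r : ℕ∞) (f : E c ≃ₜ E c) : Prop :=
  ContDiff ℝ r f ∧ ContDiff ℝ r f.symm ∧
    (r = 0 → ∃ K : NNReal, LipschitzWith K f ∧ LipschitzWith K f.symm)

/-- An arc `ε ↦ f ε`, `ε ≥ 0`, of `C^r`-diffeomorphisms of `ℝ^c`: all derivatives of order `≤ r`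
are jointly continuous in the parameter and the point, that is, `ε ↦ f ε` is continuous for the
compact-open `C^r` topology. -/
def IsArc {c : ℕ} (r : ℕ∞) (f : ℝ → (E c ≃ₜ E c)) : Prop :=
  (∀ ε, 0 ≤ ε → IsCrDiffeo r (f ε)) ∧
    ∀ j : ℕ, (j : ℕ∞) ≤ r →
      ContinuousOn (fun e : ℝ × E c => iteratedFDeriv ℝ j (f e.1) e.2) (Ici 0 ×ˢ univ)

/-! ### One-step skew-products -/

/-- The left shift on bi-infinite sequences, `(τ ξ)_n = ξ_{n+1}`. -/
def shift (ι : Type*) : Equiv.Perm (ℤ → ι) where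
  toFun ξ n := ξ (n + 1)
  invFun ξ n := ξ (n - 1)
  left_inv ξ := by funext n; simp
  right_inv ξ := by funext n; simp

/-- The one-step skew-product `(ξ, y) ↦ (τ ξ, φ_{ξ_0} y)`. -/
def skew {ι : Type*} {c : ℕ} (φ : ι → (E c ≃ₜ E c)) : Equiv.Perm ((ℤ → ι) × E c) where
  toFun z := (shift ι z.1, φ (z.1 0) z.2)
  invFun z := ((shift ι).symm z.1, (φ (z.1 (-1))).symm z.2)
  left_inv z := by
    rcases z with ⟨ξ, y⟩
    simp [shift]
  right_inv z := by
    rcases z with ⟨ξ, y⟩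
    simp [shift]

/-- The fibre map `ℝ^c → ℝ^c` of the `n`-th iterate (`n ∈ ℤ`) over the sequence `ξ`. -/
def fiberMap {ι : Type*} {c : ℕ} (φ : ι → (E c ≃ₜ E c)) (n : ℤ) (ξ : ℤ → ι) (y : E c) : E c :=
  ((skew φ ^ n) (ξ, y)).2

/-- `Γ = ⋂_{n ∈ ℤ} Φ^n (ι^ℤ × closure D)`. -/
def maxInvariantSet {ι : Type*} {c : ℕ} (φ : ι → (E c ≃ₜ E c)) (D : Set (E c)) :
    Set ((ℤ → ι) × E c) :=
  ⋂ n : ℤ, ⇑(skew φ ^ n) '' (univ ×ˢ closure D)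

/-- Topological transitivity of the skew-product on a nonempty set `Γ`. The sequence space
carries the product of the topologies of `ι` (discrete for `ι = Fin k`). -/
def IsTransitiveOn {ι : Type*} [TopologicalSpace ι] {c : ℕ} (φ : ι → (E c ≃ₜ E c))
    (Γ : Set ((ℤ → ι) × E c)) : Prop :=
  Γ.Nonempty ∧ ∀ U V : Set ((ℤ → ι) × E c), IsOpen U → IsOpen V →
    (U ∩ Γ).Nonempty → (V ∩ Γ).Nonempty →
    ∃ n : ℕ, 0 < n ∧ (⇑(skew φ ^ n) '' (U ∩ Γ) ∩ (V ∩ Γ)).Nonempty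

/-- One-step partially hyperbolic skew-products; `θ` is the number `ν ^ α`, where `ν` is the
contraction rate of the metric of the base and `α` the Hölder exponent. -/
def IsPHS {ι : Type*} {c : ℕ} (θ : ℝ) (φ : ι → (E c ≃ₜ E c)) : Prop :=
  ∃ γ γ' : ℝ, θ < γ ∧ γ < 1 ∧ θ < γ' ∧ γ' < 1 ∧ ∀ i y z,
    γ * dist y z ≤ dist (φ i y) (φ i z) ∧ dist (φ i y) (φ i z) ≤ γ'⁻¹ * dist y z

/-! ### Hyperbolicity, differentiable case -/

/-- `A` is a hyperbolic linear map whose contracting subspace has dimension `m`. -/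
def IsHyperbolicLinear {c : ℕ} (A : E c →L[ℝ] E c) (m : ℕ) : Prop :=
  ∃ (Es Eu : Submodule ℝ (E c)) (C lam : ℝ), 0 < C ∧ 0 < lam ∧ lam < 1 ∧
    IsCompl Es Eu ∧ Module.finrank ℝ Es = m ∧
    Es.map (A : E c →ₗ[ℝ] E c) = Es ∧ Eu.map (A : E c →ₗ[ℝ] E c) = Eu ∧
    (∀ v ∈ Es, ∀ n : ℕ, ‖(A ^ n) v‖ ≤ C * lam ^ n * ‖v‖) ∧
    (∀ v ∈ Eu, ∀ n : ℕ, ‖v‖ ≤ C * lam ^ n * ‖(A ^ n) v‖)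

/-- An invariant splitting of the fibre direction over `Γ`, uniformly contracted in the future on
`Es`, which has dimension `m`, and uniformly contracted in the past on `Eu`. -/
def HasHyperbolicSplitting {ι : Type*} {c : ℕ} (φ : ι → (E c ≃ₜ E c))
    (Γ : Set ((ℤ → ι) × E c)) (m : ℕ) : Prop :=
  ∃ (Es Eu : (ℤ → ι) × E c → Submodule ℝ (E c)) (C lam : ℝ), 0 < C ∧ 0 < lam ∧ lam < 1 ∧
    ∀ z ∈ Γ,
      IsCompl (Es z) (Eu z) ∧ Module.finrank ℝ (Es z) = m ∧
      (Es z).map (fderiv ℝ (φ (z.1 0)) z.2 : E c →ₗ[ℝ] E c) = Es (skew φ z) ∧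
      (Eu z).map (fderiv ℝ (φ (z.1 0)) z.2 : E c →ₗ[ℝ] E c) = Eu (skew φ z) ∧
      (∀ v ∈ Es z, ∀ n : ℕ, ‖fderiv ℝ (fiberMap φ n z.1) z.2 v‖ ≤ C * lam ^ n * ‖v‖) ∧
      (∀ v ∈ Eu z, ∀ n : ℕ, ‖fderiv ℝ (fiberMap φ (-n) z.1) z.2 v‖ ≤ C * lam ^ n * ‖v‖)

/-! ### Hyperbolicity, bi-Lipschitz case

A splitting `Es ⊕ Eu` with norms on both summands is given by two seminorms `p`, `q`, where
`p` measures the stable component (so `p` vanishes exactly on `Eu`) and `q` the unstable one. The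
Conley-Moser type requirement on a map `f` near a point is that `f` is locally given in cross form
by a contraction: `(stable part of y, unstable part of f y)` determines
`(stable part of f y, unstable part of y)`, with a Lipschitz constant smaller than one. -/

/-- `p` and `q` are the norms of the two components of a splitting whose stable summand has
dimension `m`. -/
def IsSplittingNorms {c : ℕ} (p q : Seminorm ℝ (E c)) (m : ℕ) : Prop :=
  ∃ Es Eu : Submodule ℝ (E c), IsCompl Es Eu ∧ Module.finrank ℝ Es = m ∧
    (∀ v, v ∈ Es ↔ q v = 0) ∧ (∀ v, v ∈ Eu ↔ p v = 0)

/-- On `U`, the cross form of `f` is `lam`-contracting from the norm `max p q` to the norm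
`max p' q'`. -/
def CrossContracting {c : ℕ} (f : E c → E c) (p q p' q' : Seminorm ℝ (E c)) (lam : ℝ)
    (U : Set (E c)) : Prop :=
  ∀ y ∈ U, ∀ z ∈ U,
    max (p' (f y - f z)) (q (y - z)) ≤ lam * max (p (y - z)) (q' (f y - f z))

/-- The cross form of `f` on `U` is defined for all stable parts of points of `V` and all unstable
parts of points of `W`. -/
def CrossDefined {c : ℕ} (f : E c → E c) (p q' : Seminorm ℝ (E c)) (U V W : Set (E c)) : Prop :=
  ∀ a ∈ V, ∀ b ∈ W, ∃ y ∈ U, p (y - a) = 0 ∧ q' (f y - b) = 0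

/-- The bi-Lipschitz form of hyperbolicity of a homeomorphism at a fixed point. -/
def IsLipHyperbolicAt {c : ℕ} (f : E c ≃ₜ E c) (x : E c) (m : ℕ) : Prop :=
  ∃ (p q : Seminorm ℝ (E c)) (lam η ρ : ℝ), 0 < lam ∧ lam < 1 ∧ 0 < η ∧ 0 < ρ ∧
    IsSplittingNorms p q m ∧
    CrossContracting f p q p q lam (Metric.ball x η) ∧
    CrossDefined f p q (Metric.ball x η) (Metric.ball x ρ) (Metric.ball (f x) ρ)

/-- The bi-Lipschitz form of hyperbolicity, in the fibre direction, of an invariant set of a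
one-step skew-product; the splitting and the norms may vary with the point, the norms uniformly
equivalent to the Euclidean one. -/
def HasLipHyperbolicSplitting {ι : Type*} {c : ℕ} (φ : ι → (E c ≃ₜ E c))
    (Γ : Set ((ℤ → ι) × E c)) (m : ℕ) : Prop :=
  ∃ (p q : (ℤ → ι) × E c → Seminorm ℝ (E c)) (K lam η ρ : ℝ),
    0 < K ∧ 0 < lam ∧ lam < 1 ∧ 0 < η ∧ 0 < ρ ∧
    ∀ z ∈ Γ,
      IsSplittingNorms (p z) (q z) m ∧
      (∀ v, ‖v‖ ≤ K * max (p z v) (q z v) ∧ max (p z v) (q z v) ≤ K * ‖v‖) ∧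
      CrossContracting (φ (z.1 0)) (p z) (q z) (p (skew φ z)) (q (skew φ z)) lam
        (Metric.ball z.2 η) ∧
      CrossDefined (φ (z.1 0)) (p z) (q (skew φ z))
        (Metric.ball z.2 η) (Metric.ball z.2 ρ) (Metric.ball (φ (z.1 0) z.2) ρ)

/-! ### Hyperbolic fixed points, hyperbolic sets, blending regions -/

/-- `x` is a hyperbolic fixed point of the `C^r`-diffeomorphism `f`, of `s`-index `m`. -/
def IsHyperbolicFixedPoint {c : ℕ} (r : ℕ∞) (f : E c ≃ₜ E c) (x : E c) (m : ℕ) : Prop :=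
  f x = x ∧ (r ≠ 0 → IsHyperbolicLinear (fderiv ℝ f x) m) ∧ (r = 0 → IsLipHyperbolicAt f x m)

/-- `Γ` is a hyperbolic set, of `cs`-index `m` and `cu`-index `c - m`, of the one-step
skew-product of the `C^r`-diffeomorphisms `φ i`. -/
def IsHyperbolicSet {ι : Type*} [TopologicalSpace ι] {c : ℕ} (r : ℕ∞) (φ : ι → (E c ≃ₜ E c))
    (Γ : Set ((ℤ → ι) × E c)) (m : ℕ) : Prop :=
  IsCompact Γ ∧ skew φ '' Γ = Γ ∧
    (r ≠ 0 → HasHyperbolicSplitting φ Γ m) ∧ (r = 0 → HasLipHyperbolicSplitting φ Γ m)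

/-- What the three kinds of blending regions have in common; `m` is the `cs`-index. -/
def IsPreBlending {ι : Type*} [TopologicalSpace ι] {c : ℕ} (r : ℕ∞) (φ : ι → (E c ≃ₜ E c))
    (B D : Set (E c)) (m : ℕ) : Prop :=
  IsOpen B ∧ Bornology.IsBounded B ∧ IsOpen D ∧ Bornology.IsBounded D ∧ closure B ⊆ D ∧
    IsHyperbolicSet r φ (maxInvariantSet φ D) m ∧ IsTransitiveOn φ (maxInvariantSet φ D)

/-- `B` is a `cs`-blending region with respect to `{φ i}` on `D`, of `cs`-index `m`. -/
def IsCsBlendingRegion {ι : Type*} [TopologicalSpace ι] {c : ℕ} (r : ℕ∞)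
    (φ : ι → (E c ≃ₜ E c)) (B D : Set (E c)) (m : ℕ) : Prop :=
  IsPreBlending r φ B D m ∧ closure B ⊆ ⋃ i, φ i '' B ∧ 0 < m

/-- `B` is a `cu`-blending region with respect to `{φ i}` on `D`, of `cs`-index `m`. -/
def IsCuBlendingRegion {ι : Type*} [TopologicalSpace ι] {c : ℕ} (r : ℕ∞)
    (φ : ι → (E c ≃ₜ E c)) (B D : Set (E c)) (m : ℕ) : Prop :=
  IsPreBlending r φ B D m ∧ closure B ⊆ ⋃ i, (φ i).symm '' B ∧ 0 < c - m

/-- `B` is a double-blending region with respect to `{φ i}` on `D`, of `cs`-index `m`. -/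
def IsDoubleBlendingRegion {ι : Type*} [TopologicalSpace ι] {c : ℕ} (r : ℕ∞)
    (φ : ι → (E c ≃ₜ E c)) (B D : Set (E c)) (m : ℕ) : Prop :=
  IsCsBlendingRegion r φ B D m ∧ IsCuBlendingRegion r φ B D m

end Blending

/-!
Translates of a hyperbolic map of `ℝ^c` near its fixed point `x` generate a blending region.

*Cross form.* Whether `φ` is differentiable or only bi-Lipschitz, hyperbolicity at `x` yields norms
`p`, `q` of the stable and unstable components for which `φ` is given near `x`, in cross form
`(stable part of y, unstable part of φ y) ↦ (stable part of φ y, unstable part of y)`, by a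
contraction for the maximum norm. In the differentiable case these are adapted norms of the
derivative (`exists_adapted_seminorm`), and the inverse function theorem gives the domain of the
cross form (`isLipHyperbolicAt_of_hasStrictFDerivAt`). Translations do not affect differences, so
all maps `φ + v i` contract in cross form for the same norms.

*The invariant set.* Let `D` be a small box `max p q < R` around `x` and let the vectors `v i` be
small compared with `R`. An orbit over a given sequence `ξ` is a fixed point of a contraction on
the sequences in the box, built from the cross forms (`exists_orbit_of_cross`). So over every `ξ`
there is exactly one orbit in the box, the compact invariant set `Γ` is a graph over the full
shift, and `Γ` is transitive (`isTransitiveOn_of_existsUnique`). In the bi-Lipschitz case its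
hyperbolicity is what has just been said, with constant norms. In the differentiable case the
derivatives at points of `D` inherit the contracting cross form, and the stable and unstable
directions are the vectors whose forward, respectively backward, orbits under the derivative cocycle
are bounded; the existence of enough of them is again a case of `exists_orbit_of_cross`
(`isCompl_boundedOrbits`, `hasHyperbolicSplitting_of_cross`).

*Covering.* As `φ` and its inverse are `L`-Lipschitz near `x`, the image of `B = ball x δ` contains
`ball x (δ / L)` and the image of its closure lies in `closedBall x (L * δ)`. Finitely many
translates by vectors `δ • w i` give both covering properties, and the `w i` form a net of a fixed
ball, so that their number does not depend on `δ` (`exists_finite_net`). The radius `R`, and with it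
`δ` and the translations, is taken proportional to `min ε ε₀`.
-/

open Set Filter Topology

namespace Blending

/-! ### The maximal invariant set of a skew-product -/

section Skew

variable {ι : Type*} {c : ℕ}

theorem skew_zpow_fst (F : ι → (E c ≃ₜ E c)) (n : ℤ) (z : (ℤ → ι) × E c) (j : ℤ) :
    ((skew F ^ n) z).1 j = z.1 (j + n) := by
  induction n using Int.induction_on generalizing j with
  | zero => simp
  | succ n ih =>
    rw [zpow_add_one, (Commute.zpow_self (skew F) n).eq, Equiv.Perm.mul_apply]
    change ((skew F ^ (n : ℤ)) z).1 (j + 1) = _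
    rw [ih, add_right_comm, add_assoc]
  | pred n ih =>
    rw [zpow_sub_one, (Commute.zpow_self (skew F) (-(n : ℤ))).inv_right.eq, Equiv.Perm.mul_apply]
    change ((skew F ^ (-(n : ℤ))) z).1 (j - 1) = _
    rw [ih, sub_add_eq_add_sub, add_sub_assoc]

theorem skew_zpow_add_one (F : ι → (E c ≃ₜ E c)) (n : ℤ) (z : (ℤ → ι) × E c) :
    (skew F ^ (n + 1)) z = skew F ((skew F ^ n) z) := by
  rw [zpow_add_one, (Commute.zpow_self (skew F) n).eq, Equiv.Perm.mul_apply]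

theorem skew_zpow_add_one_snd (F : ι → (E c ≃ₜ E c)) (n : ℤ) (z : (ℤ → ι) × E c) :
    ((skew F ^ (n + 1)) z).2 = F (z.1 n) ((skew F ^ n) z).2 := by
  rw [skew_zpow_add_one]
  change F (((skew F ^ n) z).1 0) _ = _
  rw [skew_zpow_fst, zero_add]

/-- A bi-infinite sequence of points which is mapped along by the fibre maps over `ξ` is the
orbit of its entry at time `0`. -/
theorem skew_zpow_snd_eq (F : ι → (E c ≃ₜ E c)) (ξ : ℤ → ι) (w : ℤ → E c)
    (hw : ∀ n, w (n + 1) = F (ξ n) (w n)) (n : ℤ) : ((skew F ^ n) (ξ, w 0)).2 = w n := by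
  induction n using Int.induction_on with
  | zero => simp
  | succ n ih => rw [skew_zpow_add_one_snd, ih, hw]
  | pred n ih =>
    have h := skew_zpow_add_one_snd F (-(n : ℤ) - 1) (ξ, w 0)
    rw [sub_add_cancel, ih, ← sub_add_cancel (-(n : ℤ)) 1, hw, sub_add_cancel] at h
    exact ((F _).injective h).symm

theorem mem_maxInvariantSet (F : ι → (E c ≃ₜ E c)) (D : Set (E c)) (z : (ℤ → ι) × E c) :
    z ∈ maxInvariantSet F D ↔ ∀ n : ℤ, ((skew F ^ n) z).2 ∈ closure D := by
  simp only [maxInvariantSet, mem_iInter]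
  have h : ∀ n : ℤ, z ∈ ⇑(skew F ^ n) '' (univ ×ˢ closure D) ↔
      ((skew F ^ (-n)) z).2 ∈ closure D := fun n => by
    rw [Equiv.image_eq_preimage_symm, ← Equiv.Perm.inv_def, ← zpow_neg]
    simp [mem_prod]
  exact ⟨fun H n => by simpa using (h (-n)).1 (H (-n)), fun H n => (h n).2 (H (-n))⟩

theorem skew_zpow_mem_maxInvariantSet {F : ι → (E c ≃ₜ E c)} {D : Set (E c)}
    {z : (ℤ → ι) × E c} (hz : z ∈ maxInvariantSet F D) (n : ℤ) :
    (skew F ^ n) z ∈ maxInvariantSet F D := by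
  rw [mem_maxInvariantSet] at hz ⊢
  intro j
  rw [← Equiv.Perm.mul_apply, ← zpow_add]
  exact hz _

theorem skew_image_maxInvariantSet (F : ι → (E c ≃ₜ E c)) (D : Set (E c)) :
    skew F '' maxInvariantSet F D = maxInvariantSet F D := by
  apply Subset.antisymm
  · rintro _ ⟨z, hz, rfl⟩
    simpa using skew_zpow_mem_maxInvariantSet hz 1
  · intro z hz
    exact ⟨_, skew_zpow_mem_maxInvariantSet hz (-1), by simp⟩

variable [TopologicalSpace ι] [DiscreteTopology ι]

theorem continuous_skew_zpow (F : ι → (E c ≃ₜ E c)) (n : ℤ) : Continuous ⇑(skew F ^ n) := by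
  have key : ∀ G : ι → (E c ≃ₜ E c), Continuous fun w : ι × E c => G w.1 w.2 := fun G =>
    continuous_prod_of_discrete_left.2 fun i => (G i).continuous
  have h1 : Continuous ⇑(skew F) := by
    refine Continuous.prodMk ?_ ((key F).comp (f := fun z : (ℤ → ι) × E c => (z.1 0, z.2))
      (by fun_prop))
    exact continuous_pi fun j => (continuous_apply (j + 1)).comp continuous_fst
  have h2 : Continuous ⇑(skew F)⁻¹ := by
    refine Continuous.prodMk ?_ ((key fun i => (F i).symm).comp
      (f := fun z : (ℤ → ι) × E c => (z.1 (-1), z.2)) (by fun_prop))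
    exact continuous_pi fun j => (continuous_apply (j - 1)).comp continuous_fst
  induction n using Int.induction_on with
  | zero => exact continuous_id
  | succ n ih => rw [zpow_add_one]; exact ih.comp h1
  | pred n ih => rw [zpow_sub_one]; exact ih.comp h2

theorem isCompact_maxInvariantSet [Finite ι] (F : ι → (E c ≃ₜ E c)) {D : Set (E c)}
    (hD : Bornology.IsBounded D) : IsCompact (maxInvariantSet F D) := by
  have hc : IsClosed (maxInvariantSet F D) := by
    have : maxInvariantSet F D = ⋂ n : ℤ, {z | ((skew F ^ n) z).2 ∈ closure D} := by
      ext z; simp [mem_maxInvariantSet]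
    rw [this]
    exact isClosed_iInter fun n =>
      isClosed_closure.preimage (continuous_snd.comp (continuous_skew_zpow F n))
  refine (isCompact_univ.prod hD.isCompact_closure).of_isClosed_subset hc fun z hz => ?_
  exact ⟨mem_univ _, by simpa using (mem_maxInvariantSet F D z).1 hz 0⟩

/-- A compact invariant set which meets every fibre in exactly one point is conjugate to the full
shift, hence transitive. -/
theorem isTransitiveOn_of_existsUnique [Nonempty ι] (F : ι → (E c ≃ₜ E c)) {D : Set (E c)}
    (hcpt : IsCompact (maxInvariantSet F D))
    (hex : ∀ ξ, ∃ y, (ξ, y) ∈ maxInvariantSet F D)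
    (huniq : ∀ ξ y y', (ξ, y) ∈ maxInvariantSet F D → (ξ, y') ∈ maxInvariantSet F D → y = y') :
    IsTransitiveOn F (maxInvariantSet F D) := by
  set Γ := maxInvariantSet F D
  -- The points of `Γ` in an open set are those over an open set of sequences: the complement is
  -- the projection of a compact set.
  have key : ∀ U : Set ((ℤ → ι) × E c), IsOpen U →
      IsOpen {ξ | ∀ y, (ξ, y) ∈ Γ → (ξ, y) ∈ U} := by
    intro U hU
    have : {ξ | ∀ y, (ξ, y) ∈ Γ → (ξ, y) ∈ U} = (Prod.fst '' (Γ \ U))ᶜ := by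
      ext ξ; simp
    rw [this]
    exact ((hcpt.diff hU).image continuous_fst).isClosed.isOpen_compl
  refine ⟨?_, fun U V hU hV => ?_⟩
  · obtain ⟨y, hy⟩ := hex fun _ => Classical.arbitrary ι
    exact ⟨_, hy⟩
  rintro ⟨⟨ξ, y⟩, hyU, hyΓ⟩ ⟨⟨η, w⟩, hwV, hwΓ⟩
  obtain ⟨I, u, hI, hIU⟩ := isOpen_pi_iff.1 (key U hU) ξ fun y' hy' => by
    rwa [huniq ξ y' y hy' hyΓ]
  obtain ⟨J, u', hJ, hJV⟩ := isOpen_pi_iff.1 (key V hV) η fun y' hy' => by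
    rwa [huniq η y' w hy' hwΓ]
  obtain ⟨b, hb⟩ := ((I ×ˢ J).image fun a => a.1 - a.2).bddAbove
  -- A time `n` so large that the windows `I` and `J + n` are disjoint.
  set n : ℕ := b.toNat + 1
  have hn : ∀ i ∈ I, ∀ j ∈ J, i < j + n := by
    intro i hi j hj
    have : i - j ≤ b := hb (by
      simp only [Finset.coe_image, mem_image, Finset.mem_coe, Finset.mem_product]
      exact ⟨(i, j), ⟨hi, hj⟩, rfl⟩)
    omega
  classical
  let ζ : ℤ → ι := fun i => if i ∈ I then ξ i else η (i - n)
  obtain ⟨a, ha⟩ := hex ζ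
  have haU : (ζ, a) ∈ U := hIU (by
    intro i hi
    have hi' : i ∈ I := hi
    simpa [ζ, hi'] using (hI i hi').2) a ha
  have hΓ := skew_zpow_mem_maxInvariantSet ha (n : ℤ)
  refine ⟨n, by omega, (skew F ^ n) (ζ, a), ⟨_, ⟨haU, ha⟩, rfl⟩, ?_, by simpa using hΓ⟩
  rw [zpow_natCast] at hΓ
  refine hJV (a := ((skew F ^ n) (ζ, a)).1) ?_ _ hΓ
  intro j hj
  have hjn : j + n ∉ I := fun h => lt_irrefl _ (hn _ h j hj)
  rw [← zpow_natCast, skew_zpow_fst]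
  simpa [ζ, hjn] using (hJ j hj).2

end Skew

/-! ### Orbits of sequences of cross-contracting relations -/

theorem continuous_seminorm {V : Type*} [NormedAddCommGroup V] [NormedSpace ℝ V]
    [FiniteDimensional ℝ V] (p : Seminorm ℝ V) : Continuous p :=
  continuousOn_univ.1 (p.convexOn.continuousOn isOpen_univ)

theorem seminorm_sub_eq_of_sub_eq_zero {V : Type*} [AddCommGroup V] [Module ℝ V]
    (p : Seminorm ℝ V) {a b : V} (h : p (a - b) = 0) (d : V) : p (a - d) = p (b - d) := by
  have h1 := map_add_le_add p (a - b) (b - d)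
  have h2 := map_add_le_add p (b - a) (a - d)
  rw [map_sub_rev] at h2
  simp only [sub_add_sub_cancel] at h1 h2
  linarith

/-- The seminorms `p` and `q` are the norms of the two components of a splitting of `V`: their
maximum is a norm, equivalent to the given one with constant `K`, and the components measured by
`p` and by `q` can be prescribed independently. -/
structure IsNormPair {V : Type*} [NormedAddCommGroup V] [NormedSpace ℝ V] (p q : Seminorm ℝ V)
    (K : ℝ) : Prop where
  one_le : 1 ≤ K
  norm_le : ∀ v, ‖v‖ ≤ K * max (p v) (q v)
  le_norm : ∀ v, max (p v) (q v) ≤ K * ‖v‖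
  mix : ∀ a b, ∃ v, p (v - a) = 0 ∧ q (v - b) = 0

section

variable {V : Type*} [NormedAddCommGroup V] [NormedSpace ℝ V] {p q : Seminorm ℝ V} {K : ℝ}

theorem IsNormPair.symm (h : IsNormPair p q K) : IsNormPair q p K where
  one_le := h.one_le
  norm_le v := by rw [max_comm]; exact h.norm_le v
  le_norm v := by rw [max_comm]; exact h.le_norm v
  mix a b := by
    obtain ⟨v, h1, h2⟩ := h.mix b a
    exact ⟨v, h2, h1⟩

theorem IsNormPair.eq_zero (h : IsNormPair p q K) {v : V} (hp : p v = 0) (hq : q v = 0) :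
    v = 0 := by
  simpa [hp, hq] using h.norm_le v

theorem IsNormPair.eq_of_sub (h : IsNormPair p q K) {v w : V} (hp : p (v - w) = 0)
    (hq : q (v - w) = 0) : v = w :=
  sub_eq_zero.1 (h.eq_zero hp hq)

variable [FiniteDimensional ℝ V]

/-- A contraction, for the supremum of the norms `max p q`, of a box in a space of sequences has
a fixed point. -/
theorem exists_fixed_sequence (hK : IsNormPair p q K) {I : Type*} {lam R : ℝ} (h0 : 0 < lam)
    (h1 : lam < 1) (hR : 0 ≤ R) (x : V) (T : (I → V) → I → V)
    (hT : ∀ w, (∀ n, max (p (w n - x)) (q (w n - x)) ≤ R) →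
      ∀ n, max (p (T w n - x)) (q (T w n - x)) ≤ R)
    (hc : ∀ w w' C, (∀ n, max (p (w n - x)) (q (w n - x)) ≤ R) →
      (∀ n, max (p (w' n - x)) (q (w' n - x)) ≤ R) →
      (∀ n, max (p (w n - w' n)) (q (w n - w' n)) ≤ C) →
      ∀ n, max (p (T w n - T w' n)) (q (T w n - T w' n)) ≤ lam * C) :
    ∃ w, (∀ n, max (p (w n - x)) (q (w n - x)) ≤ R) ∧ T w = w := by
  have hK0 : 0 ≤ K := zero_le_one.trans hK.one_le
  let u : ℕ → I → V := fun j => T^[j] fun _ => x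
  have hu1 : ∀ j, u (j + 1) = T (u j) := fun j => Function.iterate_succ_apply' _ _ _
  have hu : ∀ j n, max (p (u j n - x)) (q (u j n - x)) ≤ R := by
    intro j
    induction j with
    | zero => intro n; simpa [u] using hR
    | succ j ih => rw [hu1]; exact hT _ ih
  have hstep : ∀ j n, max (p (u (j + 1) n - u j n)) (q (u (j + 1) n - u j n)) ≤ lam ^ j * R := by
    intro j
    induction j with
    | zero => intro n; simpa [u] using hu 1 n
    | succ j ih =>
      intro n
      have := hc _ _ _ (hu (j + 1)) (hu j) ih n
      rw [← hu1, ← hu1] at this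
      rwa [pow_succ', mul_assoc]
  have hdist : ∀ n j, dist (u j n) (u (j + 1) n) ≤ K * R * lam ^ j := by
    intro n j
    rw [dist_comm, dist_eq_norm]
    calc _ ≤ _ := hK.norm_le _
      _ ≤ K * (lam ^ j * R) := mul_le_mul_of_nonneg_left (hstep j n) hK0
      _ = _ := by ring
  have : CompleteSpace V := FiniteDimensional.complete ℝ V
  choose w hw using fun n => cauchySeq_tendsto_of_complete
    (cauchySeq_of_le_geometric _ _ h1 (hdist n))
  have hwR : ∀ n, max (p (w n - x)) (q (w n - x)) ≤ R := by
    intro n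
    have hcont : Continuous fun v => max (p (v - x)) (q (v - x)) :=
      ((continuous_seminorm p).comp (by fun_prop)).max ((continuous_seminorm q).comp (by fun_prop))
    exact le_of_tendsto' ((hcont.tendsto _).comp (hw n)) fun j => hu j n
  refine ⟨w, hwR, funext fun n => ?_⟩
  have hbd : ∀ j n, max (p (u j n - w n)) (q (u j n - w n)) ≤
      K * (K * R * lam ^ j / (1 - lam)) := by
    intro j n
    refine (hK.le_norm _).trans (mul_le_mul_of_nonneg_left ?_ hK0)
    rw [← dist_eq_norm]
    exact dist_le_of_le_geometric_of_tendsto _ _ h1 (hdist n) (hw n) j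
  have hlim : Tendsto (fun j => u (j + 1) n) atTop (𝓝 (T w n)) := by
    rw [tendsto_iff_norm_sub_tendsto_zero]
    have h2 : Tendsto (fun j : ℕ => K * (lam * (K * (K * R * lam ^ j / (1 - lam))))) atTop
        (𝓝 (K * (lam * (K * (K * R * 0 / (1 - lam)))))) := by
      have := tendsto_pow_atTop_nhds_zero_of_lt_one h0.le h1
      exact (((((this.const_mul _).div_const _).const_mul _).const_mul _).const_mul _)
    simp only [mul_zero, zero_div] at h2
    refine squeeze_zero (fun _ => norm_nonneg _) (fun j => ?_) h2
    refine (hK.norm_le _).trans (mul_le_mul_of_nonneg_left ?_ hK0)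
    rw [hu1]
    exact hc _ _ _ (hu j) hwR (hbd j) n
  exact tendsto_nhds_unique hlim ((tendsto_add_atTop_iff_nat 1).2 (hw n))

/-- A bi-infinite sequence of relations, each of them given on a box in cross form by a
contraction which is defined on the whole box, has an orbit in the box. The orbit is a fixed point
of the map which replaces the entries `w n` of a sequence by the values of the cross forms at
`(w n, w (n + 1))`. -/
theorem exists_orbit_of_cross (hK : IsNormPair p q K) {lam R : ℝ} (h0 : 0 < lam)
    (h1 : lam < 1) (hR : 0 ≤ R) (x : V) (Rel : ℤ → V → V → Prop)
    (hdef : ∀ n a b, max (p (a - x)) (q (a - x)) ≤ R → max (p (b - x)) (q (b - x)) ≤ R →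
      ∃ y y', Rel n y y' ∧ p (y - a) = 0 ∧ q (y' - b) = 0 ∧ p (y' - x) ≤ R ∧ q (y - x) ≤ R)
    (hcon : ∀ n y y' z z', max (p (y - x)) (q (y - x)) ≤ R → max (p (y' - x)) (q (y' - x)) ≤ R →
      max (p (z - x)) (q (z - x)) ≤ R → max (p (z' - x)) (q (z' - x)) ≤ R →
      Rel n y y' → Rel n z z' →
      max (p (y' - z')) (q (y - z)) ≤ lam * max (p (y - z)) (q (y' - z'))) :
    ∃ w : ℤ → V, (∀ n, max (p (w n - x)) (q (w n - x)) ≤ R) ∧ ∀ n, Rel n (w n) (w (n + 1)) := by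
  choose! Y Y' hRel hp hq hp' hq' using hdef
  choose mix hm1 hm2 using hK.mix
  let T : (ℤ → V) → ℤ → V := fun w n =>
    mix (Y' (n - 1) (w (n - 1)) (w n)) (Y n (w n) (w (n + 1)))
  have hTp : ∀ w n, p (T w n - Y' (n - 1) (w (n - 1)) (w n)) = 0 := fun w n => hm1 _ _
  have hTq : ∀ w n, q (T w n - Y n (w n) (w (n + 1))) = 0 := fun w n => hm2 _ _
  have hprev : ∀ (w : ℤ → V) n, w (n - 1 + 1) = w n := fun w n => by rw [sub_add_cancel]
  obtain ⟨w, hw, hTw⟩ := exists_fixed_sequence hK h0 h1 hR x T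
    (by
      intro w hw n
      rw [seminorm_sub_eq_of_sub_eq_zero p (hTp w n), seminorm_sub_eq_of_sub_eq_zero q (hTq w n)]
      exact max_le (hp' _ _ _ (hw _) (hw _)) (hq' _ _ _ (hw _) (hw _)))
    (by
      intro w w' C hw hw' hC
      have hstep : ∀ n, max (p (Y' n (w n) (w (n + 1)) - Y' n (w' n) (w' (n + 1))))
          (q (Y n (w n) (w (n + 1)) - Y n (w' n) (w' (n + 1)))) ≤ lam * C := by
        intro n
        have hbox : ∀ v : ℤ → V, (∀ n, max (p (v n - x)) (q (v n - x)) ≤ R) →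
            max (p (Y n (v n) (v (n + 1)) - x)) (q (Y n (v n) (v (n + 1)) - x)) ≤ R ∧
            max (p (Y' n (v n) (v (n + 1)) - x)) (q (Y' n (v n) (v (n + 1)) - x)) ≤ R := by
          intro v hv
          refine ⟨max_le ?_ (hq' _ _ _ (hv _) (hv _)), max_le (hp' _ _ _ (hv _) (hv _)) ?_⟩
          · rw [seminorm_sub_eq_of_sub_eq_zero p (hp _ _ _ (hv _) (hv _))]
            exact (max_le_iff.1 (hv n)).1
          · rw [seminorm_sub_eq_of_sub_eq_zero q (hq _ _ _ (hv _) (hv _))]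
            exact (max_le_iff.1 (hv (n + 1))).2
        refine (hcon n _ _ _ _ (hbox w hw).1 (hbox w hw).2 (hbox w' hw').1 (hbox w' hw').2
          (hRel _ _ _ (hw _) (hw _)) (hRel _ _ _ (hw' _) (hw' _))).trans
          (mul_le_mul_of_nonneg_left ?_ h0.le)
        rw [seminorm_sub_eq_of_sub_eq_zero p (hp _ _ _ (hw _) (hw _)), map_sub_rev p,
          seminorm_sub_eq_of_sub_eq_zero p (hp _ _ _ (hw' _) (hw' _)), map_sub_rev p,
          seminorm_sub_eq_of_sub_eq_zero q (hq _ _ _ (hw _) (hw _)), map_sub_rev q,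
          seminorm_sub_eq_of_sub_eq_zero q (hq _ _ _ (hw' _) (hw' _)), map_sub_rev q]
        exact max_le (max_le_iff.1 (hC n)).1 (max_le_iff.1 (hC (n + 1))).2
      intro n
      rw [seminorm_sub_eq_of_sub_eq_zero p (hTp w n), map_sub_rev p,
        seminorm_sub_eq_of_sub_eq_zero p (hTp w' n), map_sub_rev p,
        seminorm_sub_eq_of_sub_eq_zero q (hTq w n), map_sub_rev q,
        seminorm_sub_eq_of_sub_eq_zero q (hTq w' n), map_sub_rev q]
      have h2 := hstep (n - 1)
      rw [hprev w, hprev w'] at h2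
      exact max_le (max_le_iff.1 h2).1 (max_le_iff.1 (hstep n)).2)
  refine ⟨w, hw, fun n => ?_⟩
  have hp1 := hTp w (n + 1)
  have hq1 := hTq w n
  rw [hTw] at hp1 hq1
  rw [add_sub_cancel_right] at hp1
  have e1 : Y n (w n) (w (n + 1)) = w n :=
    hK.eq_of_sub (hp _ _ _ (hw _) (hw _)) (by rwa [map_sub_rev])
  have e2 : Y' n (w n) (w (n + 1)) = w (n + 1) :=
    hK.eq_of_sub (by rwa [map_sub_rev]) (hq _ _ _ (hw _) (hw _))
  simpa only [e1, e2] using hRel n _ _ (hw n) (hw (n + 1))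

end

/-- Two orbits which stay close to each other for all times coincide. -/
theorem eq_zero_of_cross_of_bounded {P Q : ℤ → ℝ} {lam M : ℝ} (h0 : 0 < lam) (h1 : lam < 1)
    (hP0 : ∀ n, 0 ≤ P n) (hQ0 : ∀ n, 0 ≤ Q n) (hP : ∀ n, P n ≤ M) (hQ : ∀ n, Q n ≤ M)
    (h : ∀ n, max (P (n + 1)) (Q n) ≤ lam * max (P n) (Q (n + 1))) (n : ℤ) :
    P n = 0 ∧ Q n = 0 := by
  have key : ∀ j : ℕ, ∀ n, max (P n) (Q n) ≤ lam ^ j * M := by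
    intro j
    induction j with
    | zero => intro n; simpa using ⟨hP n, hQ n⟩
    | succ j ih =>
      intro n
      have hs : ∀ n, lam * max (P n) (Q (n + 1)) ≤ lam ^ (j + 1) * M := fun n => by
        rw [pow_succ', mul_assoc]
        exact mul_le_mul_of_nonneg_left
          (max_le (max_le_iff.1 (ih n)).1 (max_le_iff.1 (ih (n + 1))).2) h0.le
      have h2 := (h (n - 1)).trans (hs (n - 1))
      rw [sub_add_cancel] at h2
      exact max_le (max_le_iff.1 h2).1 (max_le_iff.1 ((h n).trans (hs n))).2
  have hlim : Tendsto (fun j : ℕ => lam ^ j * M) atTop (𝓝 0) := by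
    simpa using (tendsto_pow_atTop_nhds_zero_of_lt_one h0.le h1).mul_const M
  have := max_le_iff.1 (ge_of_tendsto' hlim fun j => key j n)
  exact ⟨this.1.antisymm (hP0 n), this.2.antisymm (hQ0 n)⟩

/-- Along a bounded forward orbit the second component is dominated by the first one, which
decreases exponentially: otherwise the second component would grow exponentially. -/
theorem contracted_of_cross_of_bounded {P Q : ℕ → ℝ} {lam M : ℝ} (h0 : 0 < lam) (h1 : lam < 1)
    (hP0 : ∀ n, 0 ≤ P n) (hQ : ∀ n, Q n ≤ M)
    (h : ∀ n, max (P (n + 1)) (Q n) ≤ lam * max (P n) (Q (n + 1))) (n : ℕ) :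
    Q n ≤ lam * P n ∧ P n ≤ lam ^ n * P 0 := by
  have hdom : ∀ n, Q n ≤ lam * P n := by
    intro n
    by_contra! hn
    have grow : ∀ j : ℕ, lam * P (n + j) < Q (n + j) ∧ Q n ≤ lam ^ j * Q (n + j) := by
      intro j
      induction j with
      | zero => simpa using hn
      | succ j ih =>
        obtain ⟨ha, hb⟩ := ih
        obtain ⟨h2, h3⟩ := max_le_iff.1 (h (n + j))
        rw [add_assoc] at h2 h3
        have hlt : P (n + j) < Q (n + (j + 1)) := by
          by_contra! hle
          rw [max_eq_left hle] at h3
          linarith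
        rw [max_eq_right hlt.le] at h2 h3
        have hpos : 0 < Q (n + (j + 1)) := (hP0 _).trans_lt hlt
        refine ⟨?_, hb.trans ?_⟩
        · nlinarith [mul_le_mul_of_nonneg_left h2 h0.le,
            mul_lt_mul_of_pos_right h1 hpos, mul_pos h0 hpos]
        · rw [pow_succ, mul_assoc]
          exact mul_le_mul_of_nonneg_left h3 (pow_nonneg h0.le j)
    have hpos : 0 < Q n := (mul_nonneg h0.le (hP0 n)).trans_lt hn
    have hlim : Tendsto (fun j : ℕ => lam ^ j * M) atTop (𝓝 0) := by
      simpa using (tendsto_pow_atTop_nhds_zero_of_lt_one h0.le h1).mul_const M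
    exact hpos.not_ge (ge_of_tendsto' hlim fun j => (grow j).2.trans
      (mul_le_mul_of_nonneg_left (hQ _) (pow_nonneg h0.le j)))
  refine ⟨hdom n, ?_⟩
  induction n with
  | zero => simp
  | succ n ih =>
    have h2 := (max_le_iff.1 (h n)).1
    have hstep : P (n + 1) ≤ lam * P n := by
      rcases le_total (Q (n + 1)) (P n) with hle | hle
      · rwa [max_eq_left hle] at h2
      · rw [max_eq_right hle] at h2
        have h3 := hdom (n + 1)
        have h4 : P (n + 1) ≤ lam * (lam * P (n + 1)) :=
          h2.trans (mul_le_mul_of_nonneg_left h3 h0.le)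
        have h5 : P (n + 1) = 0 := by
          refine le_antisymm ?_ (hP0 _)
          have : 0 < 1 - lam * lam := by nlinarith
          nlinarith
        rw [h5]
        exact mul_nonneg h0.le (hP0 n)
    rw [pow_succ', mul_assoc]
    exact hstep.trans (mul_le_mul_of_nonneg_left ih h0.le)

/-! ### Splittings and their norms -/

section Splitting

variable {V : Type*} [NormedAddCommGroup V] [NormedSpace ℝ V] {p q : Seminorm ℝ V}
  {Es Eu : Submodule ℝ V}

/-- In terms of the projections of a splitting, the equation which defines a cross form. -/
theorem cross_eq_of_projection_add_eq (h : IsCompl Es Eu) (hEs : ∀ v, v ∈ Es ↔ q v = 0)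
    (hEu : ∀ v, v ∈ Eu ↔ p v = 0) {y z a b : V}
    (heq : Es.projection Eu h y + Eu.projection Es h.symm z =
      Es.projection Eu h a + Eu.projection Es h.symm b) : p (y - a) = 0 ∧ q (z - b) = 0 := by
  have h1 : Es.projection Eu h (y - a) = Eu.projection Es h.symm (b - z) := by
    rw [map_sub, map_sub, sub_eq_sub_iff_add_eq_add, heq, add_comm]
  have h2 : Es.projection Eu h (y - a) = 0 := by
    refine Submodule.disjoint_def.1 h.disjoint _ (Submodule.projection_apply_mem _ _) ?_
    rw [h1]
    exact Submodule.projection_apply_mem _ _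
  have h3 : Eu.projection Es h.symm (b - z) = 0 := h1 ▸ h2
  rw [Submodule.projection_apply_eq_zero_iff] at h2 h3
  exact ⟨(hEu _).1 h2, by rw [map_sub_rev]; exact (hEs _).1 h3⟩

theorem exists_isNormPair [FiniteDimensional ℝ V] (h : IsCompl Es Eu)
    (hEs : ∀ v, v ∈ Es ↔ q v = 0)
    (hEu : ∀ v, v ∈ Eu ↔ p v = 0) : ∃ K, IsNormPair p q K := by
  have hcp := continuous_seminorm p
  have hcq := continuous_seminorm q
  have hcont : Continuous fun v => max (p v) (q v) := hcp.max hcq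
  obtain ⟨K₁, hK₁, hp⟩ := p.bound_of_continuous_normedSpace hcp
  obtain ⟨K₂, hK₂, hq⟩ := q.bound_of_continuous_normedSpace hcq
  have hpos : ∀ v ∈ Metric.sphere (0 : V) 1, 0 < max (p v) (q v) := by
    intro v hv
    by_contra! hle
    have h1 := (hEu v).2 (((le_max_left _ _).trans hle).antisymm (apply_nonneg p v))
    have h2 := (hEs v).2 (((le_max_right _ _).trans hle).antisymm (apply_nonneg q v))
    have h3 := Submodule.disjoint_def.1 h.disjoint v h2 h1
    simp [h3] at hv
  obtain ⟨ε, hε, hmin⟩ : ∃ ε, 0 < ε ∧ ∀ v ∈ Metric.sphere (0 : V) 1, ε ≤ max (p v) (q v) := by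
    rcases (Metric.sphere (0 : V) 1).eq_empty_or_nonempty with he | hne
    · exact ⟨1, one_pos, by simp [he]⟩
    · obtain ⟨v, hv, hm⟩ := (isCompact_sphere (0 : V) 1).exists_isMinOn hne hcont.continuousOn
      exact ⟨_, hpos v hv, fun w hw => hm hw⟩
  refine ⟨max 1 (max (max K₁ K₂) ε⁻¹), le_max_left _ _, fun v => ?_, fun v => ?_, fun a b => ?_⟩
  · rcases eq_or_ne v 0 with rfl | hv
    · simp
    have hn : 0 < ‖v‖ := norm_pos_iff.2 hv
    have h1 := hmin (‖v‖⁻¹ • v) (by simp [norm_smul, hn.ne'])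
    rw [map_smul_eq_mul, map_smul_eq_mul, norm_inv, norm_norm,
      ← mul_max_of_nonneg _ _ (inv_nonneg.2 hn.le), inv_mul_eq_div, le_div_iff₀ hn] at h1
    calc ‖v‖ ≤ ε⁻¹ * max (p v) (q v) := by rwa [inv_mul_eq_div, le_div_iff₀ hε, mul_comm]
      _ ≤ _ := mul_le_mul_of_nonneg_right ((le_max_right _ _).trans (le_max_right _ _))
          ((apply_nonneg p v).trans (le_max_left _ _))
  · have h1 : max K₁ K₂ ≤ max 1 (max (max K₁ K₂) ε⁻¹) :=
      (le_max_left _ _).trans (le_max_right _ _)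
    exact max_le ((hp v).trans (mul_le_mul_of_nonneg_right ((le_max_left _ _).trans h1)
      (norm_nonneg _))) ((hq v).trans (mul_le_mul_of_nonneg_right ((le_max_right _ _).trans h1)
      (norm_nonneg _)))
  · refine ⟨Es.projection Eu h a + Eu.projection Es h.symm b, ?_⟩
    refine cross_eq_of_projection_add_eq h hEs hEu ?_
    rw [map_add, map_add, Submodule.projection_apply_of_mem_left _
      (Submodule.projection_apply_mem _ _), Submodule.projection_apply_of_mem_right _
      (Submodule.projection_apply_mem _ _), Submodule.projection_apply_of_mem_left _
      (Submodule.projection_apply_mem _ _), Submodule.projection_apply_of_mem_right _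
      (Submodule.projection_apply_mem _ _), add_zero, zero_add]

/-! ### Invariant splittings for sequences of cross-contracting linear maps -/

/-- A linear map which contracts in cross form has a globally defined cross form. -/
theorem exists_cross_of_linear [FiniteDimensional ℝ V] (h : IsCompl Es Eu)
    (hEs : ∀ v, v ∈ Es ↔ q v = 0)
    (hEu : ∀ v, v ∈ Eu ↔ p v = 0) (B : V →L[ℝ] V) {lam : ℝ}
    (hB : ∀ v, max (p (B v)) (q v) ≤ lam * max (p v) (q (B v))) (a b : V) :
    ∃ y, p (y - a) = 0 ∧ q (B y - b) = 0 := by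
  let H : V →ₗ[ℝ] V := Es.projection Eu h + Eu.projection Es h.symm ∘ₗ (B : V →ₗ[ℝ] V)
  have hinj : Function.Injective H := by
    rw [← LinearMap.ker_eq_bot, LinearMap.ker_eq_bot']
    intro v hv
    obtain ⟨h1, h2⟩ := cross_eq_of_projection_add_eq h hEs hEu (y := v) (z := B v) (a := 0)
      (b := 0) (by simpa [H] using hv)
    rw [sub_zero] at h1 h2
    have h3 := (max_le_iff.1 (hB v)).2
    rw [h1, h2, max_self, mul_zero] at h3
    exact Submodule.disjoint_def.1 h.disjoint v ((hEs v).2 (h3.antisymm (apply_nonneg q v)))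
      ((hEu v).2 h1)
  obtain ⟨y, hy⟩ := LinearMap.surjective_of_injective hinj
    (Es.projection Eu h a + Eu.projection Es h.symm b)
  exact ⟨y, cross_eq_of_projection_add_eq h hEs hEu (by simpa [H] using hy)⟩

/-- The vectors with bounded orbit under a sequence of linear maps. -/
def boundedOrbits (L : ℕ → V →L[ℝ] V) : Submodule ℝ V where
  carrier := {v | ∃ M, ∀ n, ‖L n v‖ ≤ M}
  add_mem' := by
    rintro v w ⟨M, hM⟩ ⟨M', hM'⟩
    refine ⟨M + M', fun n => ?_⟩
    rw [map_add]
    exact (norm_add_le _ _).trans (add_le_add (hM n) (hM' n))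
  zero_mem' := ⟨0, by simp⟩
  smul_mem' := by
    rintro t v ⟨M, hM⟩
    refine ⟨‖t‖ * M, fun n => ?_⟩
    rw [map_smul, norm_smul]
    exact mul_le_mul_of_nonneg_left (hM n) (norm_nonneg _)

theorem mem_boundedOrbits {L : ℕ → V →L[ℝ] V} {v : V} :
    v ∈ boundedOrbits L ↔ ∃ M, ∀ n, ‖L n v‖ ≤ M := Iff.rfl

variable {K lam : ℝ} {B L : ℕ → V →L[ℝ] V}

theorem le_of_mem_boundedOrbits (hK : IsNormPair p q K) (h0 : 0 < lam) (h1 : lam < 1)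
    (hB : ∀ n v, max (p (B n v)) (q v) ≤ lam * max (p v) (q (B n v)))
    (hL0 : ∀ v, L 0 v = v) (hL : ∀ n v, L (n + 1) v = B n (L n v)) {v : V}
    (hv : v ∈ boundedOrbits L) :
    q v ≤ lam * p v ∧ ∀ n, ‖L n v‖ ≤ K ^ 2 * lam ^ n * ‖v‖ := by
  obtain ⟨M, hM⟩ := hv
  have hK0 : 0 ≤ K := zero_le_one.trans hK.one_le
  have key := contracted_of_cross_of_bounded (P := fun n => p (L n v)) (Q := fun n => q (L n v))
    (M := K * M) h0 h1 (fun n => apply_nonneg p _)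
    (fun n => (le_max_right _ _).trans ((hK.le_norm _).trans
      (mul_le_mul_of_nonneg_left (hM n) hK0)))
    (fun n => by simpa only [hL] using hB n (L n v))
  refine ⟨by simpa [hL0] using (key 0).1, fun n => ?_⟩
  obtain ⟨h2, h3⟩ := key n
  have h4 : q (L n v) ≤ p (L n v) :=
    h2.trans (mul_le_of_le_one_left (apply_nonneg p _) h1.le)
  simp only [hL0] at h3
  calc ‖L n v‖ ≤ K * max (p (L n v)) (q (L n v)) := hK.norm_le _
    _ ≤ K * (lam ^ n * p v) := by
      rw [max_eq_left h4]
      exact mul_le_mul_of_nonneg_left h3 hK0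
    _ ≤ K * (lam ^ n * (K * ‖v‖)) := by
      gcongr
      exact (le_max_left _ _).trans (hK.le_norm v)
    _ = _ := by ring

/-- The vectors with bounded orbit form a complement of the expanding directions. That there are
enough of them follows by prescribing the stable component at time `0` instead of the past. -/
theorem isCompl_boundedOrbits [FiniteDimensional ℝ V] (hK : IsNormPair p q K)
    (h0 : 0 < lam) (h1 : lam < 1)
    (h : IsCompl Es Eu) (hEs : ∀ v, v ∈ Es ↔ q v = 0) (hEu : ∀ v, v ∈ Eu ↔ p v = 0)
    (hB : ∀ n v, max (p (B n v)) (q v) ≤ lam * max (p v) (q (B n v)))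
    (hL0 : ∀ v, L 0 v = v) (hL : ∀ n v, L (n + 1) v = B n (L n v)) :
    IsCompl (boundedOrbits L) Eu := by
  refine ⟨Submodule.disjoint_def.2 fun v hv hv' => ?_, ?_⟩
  · have h2 := (le_of_mem_boundedOrbits hK h0 h1 hB hL0 hL hv).1
    rw [(hEu v).1 hv', mul_zero] at h2
    exact hK.eq_zero ((hEu v).1 hv') (h2.antisymm (apply_nonneg q v))
  rw [codisjoint_iff, eq_top_iff]
  intro a _
  -- For `n < 0` the cross form is constant, with stable part `a`; this fixes the stable part at
  -- time `0` of the orbit found below.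
  let Rel : ℤ → V → V → Prop := fun n y y' =>
    (0 ≤ n → y' = B n.toNat y) ∧ (n < 0 → p (y' - a) = 0 ∧ q y = 0)
  obtain ⟨w, hw, hRel⟩ := exists_orbit_of_cross hK h0 h1
    (R := max (p a) (q a)) ((apply_nonneg p a).trans (le_max_left _ _)) 0 Rel
    (by
      intro n a' b ha' hb
      simp only [sub_zero] at ha' hb ⊢
      rcases le_or_gt 0 n with hn | hn
      · obtain ⟨y, hy1, hy2⟩ := exists_cross_of_linear h hEs hEu _ (hB n.toNat) a' b
        refine ⟨y, B n.toNat y, ⟨fun _ => rfl, fun hn' => absurd hn hn'.not_ge⟩, hy1, hy2, ?_⟩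
        have h2 := seminorm_sub_eq_of_sub_eq_zero p hy1 0
        have h3 := seminorm_sub_eq_of_sub_eq_zero q hy2 0
        simp only [sub_zero] at h2 h3
        have h4 := hB n.toNat y
        rw [h2, h3] at h4
        have h5 : lam * max (p a') (q b) ≤ max (p a) (q a) := by
          have h6 : max (p a') (q b) ≤ max (p a) (q a) :=
            max_le (max_le_iff.1 ha').1 (max_le_iff.1 hb).2
          exact (mul_le_of_le_one_left
            ((apply_nonneg p a').trans (le_max_left _ _)) h1.le).trans h6
        exact max_le_iff.1 (h4.trans h5)
      · obtain ⟨y, hy1, hy2⟩ := hK.mix a' 0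
        obtain ⟨y', hy1', hy2'⟩ := hK.mix a b
        rw [sub_zero] at hy2
        refine ⟨y, y', ⟨fun hn' => absurd hn hn'.not_gt, fun _ => ⟨hy1', hy2⟩⟩, hy1, hy2', ?_, ?_⟩
        · have h2 := seminorm_sub_eq_of_sub_eq_zero p hy1' 0
          simp only [sub_zero] at h2
          rw [h2]
          exact le_max_left _ _
        · rw [hy2]
          exact (apply_nonneg p a).trans (le_max_left _ _))
    (by
      intro n y y' z z' _ _ _ _ hy hz
      rcases le_or_gt 0 n with hn | hn
      · rw [hy.1 hn, hz.1 hn, ← map_sub]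
        exact hB _ _
      · obtain ⟨hy1, hy2⟩ := hy.2 hn
        obtain ⟨hz1, hz2⟩ := hz.2 hn
        have h2 : p (y' - z') = 0 := by
          rw [seminorm_sub_eq_of_sub_eq_zero p hy1, map_sub_rev, hz1]
        have h3 : q (y - z) = 0 := by
          have := seminorm_sub_eq_of_sub_eq_zero q (a := y) (b := 0) (by simpa using hy2) z
          rw [this, zero_sub, map_neg_eq_map, hz2]
        rw [h2, h3, max_self]
        exact mul_nonneg h0.le ((apply_nonneg p _).trans (le_max_left _ _)))
  have hwL : ∀ n : ℕ, L n (w 0) = w n := by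
    intro n
    induction n with
    | zero => exact hL0 _
    | succ n ih =>
      rw [hL, ih, Nat.cast_succ, (hRel n).1 (Int.natCast_nonneg n), Int.toNat_natCast]
  have hmem : w 0 ∈ boundedOrbits L := by
    refine ⟨K * max (p a) (q a), fun n => ?_⟩
    rw [hwL]
    have h2 := hw n
    rw [sub_zero] at h2
    exact (hK.norm_le _).trans (mul_le_mul_of_nonneg_left h2 (zero_le_one.trans hK.one_le))
  have ha : p (w 0 - a) = 0 := by simpa using ((hRel (-1)).2 (by norm_num)).1
  have : a = w 0 + (a - w 0) := by abel
  rw [this]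
  exact Submodule.add_mem_sup hmem ((hEu _).2 (by rwa [map_sub_rev]))

end Splitting

/-! ### The derivative cocycle of a skew-product -/

section Cocycle

variable {ι : Type*} {c : ℕ} {F : ι → (E c ≃ₜ E c)}

theorem fiberMap_add (F : ι → (E c ≃ₜ E c)) (a b : ℤ) (ξ : ℤ → ι) :
    fiberMap F (a + b) ξ = fiberMap F a (fun j => ξ (j + b)) ∘ fiberMap F b ξ := by
  funext y
  have : ((skew F ^ b) (ξ, y)).1 = fun j => ξ (j + b) := funext fun j => skew_zpow_fst F b _ j
  simp only [fiberMap, Function.comp_apply, zpow_add, Equiv.Perm.mul_apply, ← this]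

theorem fiberMap_one (F : ι → (E c ≃ₜ E c)) (ξ : ℤ → ι) : fiberMap F 1 ξ = F (ξ 0) := by
  funext y
  simp [fiberMap, skew]

theorem fiberMap_neg_one (F : ι → (E c ≃ₜ E c)) (ξ : ℤ → ι) :
    fiberMap F (-1) ξ = (F (ξ (-1))).symm := by
  funext y
  simp only [fiberMap, zpow_neg_one]
  rfl

theorem fiberMap_zero (F : ι → (E c ≃ₜ E c)) (ξ : ℤ → ι) : fiberMap F 0 ξ = id := by
  funext y
  simp [fiberMap]

theorem differentiable_fiberMap (hF : ∀ i, Differentiable ℝ (F i))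
    (hF' : ∀ i, Differentiable ℝ (F i).symm) (n : ℤ) (ξ : ℤ → ι) :
    Differentiable ℝ (fiberMap F n ξ) := by
  induction n using Int.induction_on with
  | zero => rw [fiberMap_zero]; exact differentiable_id
  | succ n ih => rw [add_comm, fiberMap_add, fiberMap_one]; exact (hF _).comp ih
  | pred n ih =>
    rw [sub_eq_add_neg, add_comm, fiberMap_add, fiberMap_neg_one]; exact (hF' _).comp ih

theorem fderiv_fiberMap_add (hF : ∀ i, Differentiable ℝ (F i))
    (hF' : ∀ i, Differentiable ℝ (F i).symm) (a b : ℤ) (z : (ℤ → ι) × E c) (v : E c) :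
    fderiv ℝ (fiberMap F (a + b) z.1) z.2 v =
      fderiv ℝ (fiberMap F a ((skew F ^ b) z).1) ((skew F ^ b) z).2
        (fderiv ℝ (fiberMap F b z.1) z.2 v) := by
  have h1 : ((skew F ^ b) z).1 = fun j => z.1 (j + b) := funext fun j => skew_zpow_fst F b _ j
  rw [fiberMap_add, fderiv_comp _ (differentiable_fiberMap hF hF' _ _ _)
    (differentiable_fiberMap hF hF' _ _ _), h1]
  rfl

/-- If the derivatives of the fibre maps are contracting in cross form at the points of an
invariant set, for one and the same splitting, then the set is hyperbolic: the stable and unstable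
directions consist of the vectors with bounded forward and backward orbits. -/
theorem hasHyperbolicSplitting_of_cross {p q : Seminorm ℝ (E c)} {K lam : ℝ} {m : ℕ}
    (hF : ∀ i, Differentiable ℝ (F i)) (hF' : ∀ i, Differentiable ℝ (F i).symm)
    (hpq : IsSplittingNorms p q m) (hK : IsNormPair p q K) (h0 : 0 < lam) (h1 : lam < 1)
    {Γ : Set ((ℤ → ι) × E c)} (hΓ : ∀ z ∈ Γ, ∀ n : ℤ, (skew F ^ n) z ∈ Γ)
    (hcross : ∀ z ∈ Γ, ∀ v, max (p (fderiv ℝ (F (z.1 0)) z.2 v)) (q v) ≤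
      lam * max (p v) (q (fderiv ℝ (F (z.1 0)) z.2 v))) :
    HasHyperbolicSplitting F Γ m := by
  obtain ⟨Fs, Fu, hcompl, hdim, hFs, hFu⟩ := hpq
  let A : ℤ → (ℤ → ι) × E c → E c →L[ℝ] E c := fun n z => fderiv ℝ (fiberMap F n z.1) z.2
  have hA1 : ∀ z, A 1 z = fderiv ℝ (F (z.1 0)) z.2 := fun z => by simp only [A, fiberMap_one]
  have hA0 : ∀ z v, A 0 z v = v := fun z v => by simp [A, fiberMap_zero]
  have hadd : ∀ a b z v, A (a + b) z v = A a ((skew F ^ b) z) (A b z v) :=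
    fderiv_fiberMap_add hF hF'
  have hinv : ∀ z v, A (-1) (skew F z) (A 1 z v) = v := fun z v => by
    have := hadd (-1) 1 z v
    rwa [zpow_one, neg_add_cancel, hA0, eq_comm] at this
  have hinv' : ∀ z v, A 1 z (A (-1) (skew F z) v) = v := fun z v => by
    have := hadd 1 (-1) (skew F z) v
    have hz : (skew F ^ (-1 : ℤ)) (skew F z) = z := by simp
    rwa [hz, add_neg_cancel, hA0, eq_comm] at this
  have hf : ∀ z ∈ Γ, ∀ (n : ℕ) v, max (p (A 1 ((skew F ^ (n : ℤ)) z) v)) (q v) ≤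
      lam * max (p v) (q (A 1 ((skew F ^ (n : ℤ)) z) v)) := by
    intro z hz n v
    rw [hA1]
    exact hcross _ (hΓ z hz n) v
  have hb : ∀ z ∈ Γ, ∀ (n : ℕ) v, max (q (A (-1) ((skew F ^ (-n : ℤ)) z) v)) (p v) ≤
      lam * max (q v) (p (A (-1) ((skew F ^ (-n : ℤ)) z) v)) := by
    intro z hz n v
    obtain ⟨y, hy, hyz⟩ : ∃ y ∈ Γ, skew F y = (skew F ^ (-n : ℤ)) z :=
      ⟨_, hΓ _ (hΓ z hz (-n)) (-1), by simp⟩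
    have := hcross y hy (A (-1) (skew F y) v)
    rw [← hA1, hinv'] at this
    rw [← hyz, max_comm, max_comm (q v)]
    exact this
  have hLf : ∀ z, ∀ (n : ℕ) v, A ((n + 1 : ℕ) : ℤ) z v =
      A 1 ((skew F ^ (n : ℤ)) z) (A (n : ℤ) z v) := by
    intro z n v
    rw [← hadd, Nat.cast_succ, add_comm]
  have hLb : ∀ z, ∀ (n : ℕ) v, A (-((n + 1 : ℕ) : ℤ)) z v =
      A (-1) ((skew F ^ (-n : ℤ)) z) (A (-n : ℤ) z v) := by
    intro z n v
    rw [← hadd, Nat.cast_succ, neg_add_rev]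
  let Es : (ℤ → ι) × E c → Submodule ℝ (E c) := fun z => boundedOrbits fun n : ℕ => A n z
  let Eu : (ℤ → ι) × E c → Submodule ℝ (E c) := fun z => boundedOrbits fun n : ℕ => A (-n) z
  have hEs : ∀ z v, A 1 z v ∈ Es (skew F z) ↔ v ∈ Es z := by
    intro z v
    have h2 : ∀ n : ℕ, A n (skew F z) (A 1 z v) = A ((n + 1 : ℕ) : ℤ) z v := fun n => by
      rw [Nat.cast_succ, hadd, zpow_one]
    simp only [Es, mem_boundedOrbits, h2]
    constructor
    · rintro ⟨M, hM⟩
      refine ⟨max M ‖A 0 z v‖, fun n => ?_⟩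
      rcases n with - | n
      · exact le_max_right _ _
      · exact (hM n).trans (le_max_left _ _)
    · rintro ⟨M, hM⟩
      exact ⟨M, fun n => hM (n + 1)⟩
  have hEu : ∀ z v, A 1 z v ∈ Eu (skew F z) ↔ v ∈ Eu z := by
    intro z v
    have h2 : ∀ n : ℕ, A (-((n + 1 : ℕ) : ℤ)) (skew F z) (A 1 z v) = A (-n : ℤ) z v := fun n => by
      rw [← zpow_one (skew F), ← hadd]
      congr 2
      push_cast
      ring
    simp only [Eu, mem_boundedOrbits]
    constructor
    · rintro ⟨M, hM⟩
      exact ⟨M, fun n => by rw [← h2]; exact hM (n + 1)⟩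
    · rintro ⟨M, hM⟩
      refine ⟨max M ‖A (-(0 : ℕ)) (skew F z) (A 1 z v)‖, fun n => ?_⟩
      rcases n with - | n
      · exact le_max_right _ _
      · rw [h2]
        exact (hM n).trans (le_max_left _ _)
  have hmap : ∀ S : (ℤ → ι) × E c → Submodule ℝ (E c),
      (∀ z v, A 1 z v ∈ S (skew F z) ↔ v ∈ S z) → ∀ z,
      (S z).map (fderiv ℝ (F (z.1 0)) z.2 : E c →ₗ[ℝ] E c) = S (skew F z) := by
    intro S hS z
    rw [← hA1]
    ext w
    simp only [Submodule.mem_map, ContinuousLinearMap.coe_coe]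
    constructor
    · rintro ⟨v, hv, rfl⟩
      exact (hS z v).2 hv
    · intro hw
      exact ⟨A (-1) (skew F z) w, (hS z _).1 (by rwa [hinv']), hinv' z w⟩
  have hK0 : 0 < K := zero_lt_one.trans_le hK.one_le
  refine ⟨Es, Eu, K ^ 2, lam, pow_pos hK0 2, h0, h1, fun z hz => ?_⟩
  have c1 : IsCompl (Es z) Fu := isCompl_boundedOrbits hK h0 h1 hcompl hFs hFu (hf z hz)
    (hA0 z) (hLf z)
  have c2 : IsCompl (Eu z) Fs := isCompl_boundedOrbits hK.symm h0 h1 hcompl.symm hFu hFs (hb z hz)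
    (by simpa using hA0 z) (hLb z)
  have l1 := fun v (hv : v ∈ Es z) => le_of_mem_boundedOrbits hK h0 h1 (hf z hz)
    (hA0 z) (hLf z) hv
  have l2 := fun v (hv : v ∈ Eu z) => le_of_mem_boundedOrbits hK.symm h0 h1 (hb z hz)
    (by simpa using hA0 z) (hLb z) hv
  have d0 := Submodule.finrank_add_eq_of_isCompl hcompl
  have d1 := Submodule.finrank_add_eq_of_isCompl c1
  have d2 := Submodule.finrank_add_eq_of_isCompl c2
  have hdisj : Disjoint (Es z) (Eu z) := Submodule.disjoint_def.2 fun v hv hv' => by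
    have e1 := (l1 v hv).1
    have e2 := (l2 v hv').1
    have e3 : q v ≤ lam * (lam * q v) := e1.trans (mul_le_mul_of_nonneg_left e2 h0.le)
    have e4 : q v = 0 := by
      refine le_antisymm ?_ (apply_nonneg q v)
      have : 0 < 1 - lam * lam := by nlinarith
      nlinarith
    rw [e4, mul_zero] at e2
    exact hK.eq_zero (e2.antisymm (apply_nonneg p v)) e4
  refine ⟨⟨hdisj, codisjoint_iff.2 (Submodule.eq_top_of_disjoint _ _ (by omega) hdisj)⟩,
    by omega, hmap Es hEs z, hmap Eu hEu z, fun v hv n => (l1 v hv).2 n,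
    fun v hv n => (l2 v hv).2 n⟩

end Cocycle

/-! ### Differentiable and bi-Lipschitz hyperbolicity of a fixed point -/

/-- The derivative inherits the contracting cross form, as a limit of difference quotients. -/
theorem le_of_crossContracting_of_hasFDerivAt {c : ℕ} {f : E c → E c} {p q : Seminorm ℝ (E c)}
    {lam : ℝ} {U : Set (E c)} (hU : IsOpen U) (hf : CrossContracting f p q p q lam U)
    {y : E c} (hy : y ∈ U) {A : E c →L[ℝ] E c} (hA : HasFDerivAt f A y) (v : E c) :
    max (p (A v)) (q v) ≤ lam * max (p v) (q (A v)) := by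
  have hpc := continuous_seminorm p
  have hqc := continuous_seminorm q
  have hlim := hA.lim_real v
  have hmem : ∀ᶠ t : ℝ in atTop, y + t⁻¹ • v ∈ U := by
    have h2 : Tendsto (fun t : ℝ => y + t⁻¹ • v) atTop (𝓝 (y + (0 : ℝ) • v)) :=
      tendsto_const_nhds.add (tendsto_inv_atTop_zero.smul_const v)
    rw [zero_smul, add_zero] at h2
    exact h2 (hU.mem_nhds hy)
  refine le_of_tendsto_of_tendsto (((hpc.tendsto _).comp hlim).max tendsto_const_nhds)
    ((tendsto_const_nhds.max ((hqc.tendsto _).comp hlim)).const_mul lam) ?_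
  filter_upwards [hmem, eventually_gt_atTop 0] with t ht ht0
  have h3 := hf _ ht y hy
  rw [add_sub_cancel_left, map_smul_eq_mul, map_smul_eq_mul, norm_inv, Real.norm_of_nonneg ht0.le]
    at h3
  have h4 := mul_le_mul_of_nonneg_left h3 ht0.le
  rw [mul_left_comm, mul_max_of_nonneg _ _ ht0.le, mul_max_of_nonneg _ _ ht0.le,
    mul_inv_cancel_left₀ ht0.ne', mul_inv_cancel_left₀ ht0.ne'] at h4
  simpa only [Function.comp_apply, map_smul_eq_mul, Real.norm_of_nonneg ht0.le] using h4

/-- The adapted norm `sup_n lam ^ (-n) ‖A ^ n v‖` of the component in a contracted invariant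
subspace: one application of `A` contracts it by the factor `lam`. -/
theorem exists_adapted_seminorm {V : Type*} [NormedAddCommGroup V] [NormedSpace ℝ V]
    {Es Eu : Submodule ℝ V} (h : IsCompl Es Eu) (A : V →L[ℝ] V) (hAs : ∀ v ∈ Es, A v ∈ Es)
    (hAu : ∀ v ∈ Eu, A v ∈ Eu) {C lam : ℝ} (h0 : 0 < lam)
    (hC : ∀ v ∈ Es, ∀ n : ℕ, ‖(A ^ n) v‖ ≤ C * lam ^ n * ‖v‖) :
    ∃ p : Seminorm ℝ V, (∀ v, v ∈ Eu ↔ p v = 0) ∧ ∀ v, p (A v) ≤ lam * p v := by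
  let P := Es.projection Eu h
  have hP : ∀ v, P v ∈ Es := fun v => Submodule.projection_apply_mem _ _
  have hPA : ∀ v, P (A v) = A (P v) := by
    intro v
    have h2 : v - P v ∈ Eu := by
      rw [← Submodule.projection_apply_eq_zero_iff h, map_sub,
        Submodule.projection_apply_of_mem_left h (hP v)]
      exact sub_self _
    have h3 : P (A (P v) + A (v - P v)) = A (P v) := by
      rw [map_add, Submodule.projection_apply_of_mem_left h (hAs _ (hP v)),
        Submodule.projection_apply_of_mem_right h (hAu _ h2), add_zero]
    rwa [← map_add, add_sub_cancel] at h3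
  let a : V → ℕ → ℝ := fun v n => (lam ^ n)⁻¹ * ‖(A ^ n) (P v)‖
  have hbdd : ∀ v, BddAbove (range (a v)) := by
    intro v
    refine ⟨C * ‖P v‖, ?_⟩
    rintro _ ⟨n, rfl⟩
    change (lam ^ n)⁻¹ * ‖(A ^ n) (P v)‖ ≤ _
    rw [inv_mul_le_iff₀ (pow_pos h0 n)]
    calc _ ≤ _ := hC _ (hP v) n
      _ = _ := by ring
  let p : Seminorm ℝ V := Seminorm.of (fun v => ⨆ n, a v n)
    (fun v w => ciSup_le fun n => by
      refine le_trans ?_ (add_le_add (le_ciSup (hbdd v) n) (le_ciSup (hbdd w) n))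
      simp only [a, map_add]
      rw [← mul_add]
      exact mul_le_mul_of_nonneg_left (norm_add_le _ _) (by positivity))
    (fun t v => by
      rw [Real.mul_iSup_of_nonneg (norm_nonneg t)]
      refine iSup_congr fun n => ?_
      simp only [a, map_smul, norm_smul]
      ring)
  have hp : ∀ v, p v = ⨆ n, a v n := fun v => rfl
  refine ⟨p, fun v => ⟨fun hv => ?_, fun hv => ?_⟩, fun v => ?_⟩
  · have : P v = 0 := Submodule.projection_apply_of_mem_right h hv
    simp [hp, a, this]
  · rw [← Submodule.projection_apply_eq_zero_iff h, ← norm_le_zero_iff, ← hv, hp]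
    simpa [a] using le_ciSup (hbdd v) 0
  · rw [hp]
    refine ciSup_le fun n => ?_
    have h2 : a (A v) n = lam * a v (n + 1) := by
      simp only [a, hPA]
      rw [pow_succ A n, mul_apply_eq_comp, pow_succ' lam n, mul_inv, mul_assoc,
        mul_inv_cancel_left₀ h0.ne']
    rw [h2]
    exact mul_le_mul_of_nonneg_left (le_ciSup (hbdd v) (n + 1)) h0.le

/-- A fixed point with hyperbolic derivative is hyperbolic in the bi-Lipschitz sense: for adapted
norms the cross form of the derivative is a contraction, hence so is that of the map near the fixed
point, and the inverse function theorem provides its domain. -/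
theorem isLipHyperbolicAt_of_hasStrictFDerivAt {c : ℕ} {f : E c ≃ₜ E c} {x : E c} {m : ℕ}
    {A : E c →L[ℝ] E c} (hf : HasStrictFDerivAt f A x) (hA : IsHyperbolicLinear A m) :
    IsLipHyperbolicAt f x m := by
  obtain ⟨Es, Eu, C, lam, -, h0, h1, hcompl, hdim, hAs, hAu, hCs, hCu⟩ := hA
  have hmem : ∀ {S : Submodule ℝ (E c)}, S.map (A : E c →ₗ[ℝ] E c) = S → ∀ v ∈ S, A v ∈ S :=
    fun hS v hv => hS ▸ Submodule.mem_map_of_mem (f := (A : E c →ₗ[ℝ] E c)) hv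
  have hsurj : Function.Surjective A := by
    have h2 : LinearMap.range (A : E c →ₗ[ℝ] E c) = ⊤ := by
      rw [LinearMap.range_eq_map, ← hcompl.sup_eq_top, Submodule.map_sup, hAs, hAu]
    exact LinearMap.range_eq_top.1 h2
  have hinj : Function.Injective A :=
    (LinearMap.injective_iff_surjective (f := (A : E c →ₗ[ℝ] E c))).2 hsurj
  let Aeq := (LinearEquiv.ofBijective (A : E c →ₗ[ℝ] E c) ⟨hinj, hsurj⟩).toContinuousLinearEquiv
  let B : E c →L[ℝ] E c := Aeq.symm
  have hAB : ∀ v, A (B v) = v := fun v => Aeq.apply_symm_apply v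
  have hBA : ∀ v, B (A v) = v := fun v => Aeq.symm_apply_apply v
  have hmemB : ∀ {S : Submodule ℝ (E c)}, S.map (A : E c →ₗ[ℝ] E c) = S → ∀ v ∈ S, B v ∈ S := by
    intro S hS v hv
    rw [← hS] at hv
    obtain ⟨u, hu, rfl⟩ := hv
    simpa [hBA] using hu
  obtain ⟨p, hp0, hp⟩ := exists_adapted_seminorm hcompl A (hmem hAs) (hmem hAu) h0 hCs
  obtain ⟨q, hq0, hq'⟩ := exists_adapted_seminorm hcompl.symm B (hmemB hAu) (hmemB hAs) h0
    (C := C) (by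
      intro v hv n
      have h2 : ∀ n : ℕ, (B ^ n) v ∈ Eu := by
        intro n
        induction n with
        | zero => simpa using hv
        | succ n ih => rw [pow_succ', mul_apply_eq_comp]; exact hmemB hAu _ ih
      have h3 : A ^ n * B ^ n = 1 :=
        pow_mul_pow_eq_one n (ContinuousLinearMap.ext fun v => hAB v)
      have h4 := hCu _ (h2 n) n
      rwa [← mul_apply_eq_comp, h3, one_apply_eq_self] at h4)
  have hq : ∀ v, q v ≤ lam * q (A v) := fun v => by simpa [hBA] using hq' (A v)
  obtain ⟨K, hK⟩ := exists_isNormPair hcompl hq0 hp0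
  have hK0 : 0 < K := zero_lt_one.trans_le hK.one_le
  -- Deviations from the derivative which are `e`-Lipschitz do no harm.
  set e : ℝ := (1 - lam) / 4 with he
  have he0 : 0 < e := by rw [he]; linarith
  have he1 : e < 1 := by rw [he]; linarith
  set mu : ℝ := (lam + e) / (1 - e) with hmu
  have hmu0 : 0 < mu := div_pos (by linarith) (by linarith)
  have hmu1 : mu < 1 := by rw [hmu, div_lt_one (by linarith)]; linarith
  obtain ⟨s, hs, happ⟩ := hf.approximates_deriv_on_nhds (c := (e / K ^ 2).toNNReal)
    (Or.inr (Real.toNNReal_pos.2 (by positivity)))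
  obtain ⟨η, hη, hηs⟩ := Metric.mem_nhds_iff.1 hs
  have herr : ∀ y ∈ Metric.ball x η, ∀ z ∈ Metric.ball x η,
      max (p (f y - f z - A (y - z))) (q (f y - f z - A (y - z))) ≤
        e * max (p (y - z)) (q (y - z)) := by
    intro y hy z hz
    have h2 := happ y (hηs hy) z (hηs hz)
    rw [Real.coe_toNNReal _ (by positivity)] at h2
    calc _ ≤ K * ‖f y - f z - A (y - z)‖ := hK.le_norm _
      _ ≤ K * (e / K ^ 2 * (K * max (p (y - z)) (q (y - z)))) := by
        gcongr
        exact h2.trans (mul_le_mul_of_nonneg_left (hK.norm_le _) (by positivity))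
      _ = _ := by field_simp
  have hcross : CrossContracting f p q p q mu (Metric.ball x η) := by
    intro y hy z hz
    obtain ⟨e1, e2⟩ := max_le_iff.1 (herr y hy z hz)
    have p1 : p (f y - f z) ≤ lam * p (y - z) + e * max (p (y - z)) (q (y - z)) := by
      have h2 := map_add_le_add p (A (y - z)) (f y - f z - A (y - z))
      rw [add_sub_cancel] at h2
      linarith [hp (y - z)]
    have q1 : q (y - z) ≤ lam * q (f y - f z) + e * max (p (y - z)) (q (y - z)) := by
      have h2 := map_sub_le_add q (f y - f z) (f y - f z - A (y - z))
      rw [sub_sub_cancel] at h2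
      have h3 := hq (y - z)
      have h4 := mul_le_mul_of_nonneg_left h2 h0.le
      have h5 := apply_nonneg q (f y - f z - A (y - z))
      nlinarith
    have hp2 := apply_nonneg p (y - z)
    have hq2 := apply_nonneg q (y - z)
    have hM1 := le_max_left (p (y - z)) (q (f y - f z))
    have hM2 := le_max_right (p (y - z)) (q (f y - f z))
    set M := max (p (y - z)) (q (f y - f z))
    have hM0 : 0 ≤ M := hp2.trans hM1
    have hle : lam + e ≤ mu := by
      rw [hmu, le_div_iff₀ (by linarith)]
      nlinarith
    have hmue : mu * (1 - e) = lam + e := div_mul_cancel₀ _ (by linarith)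
    have hlM := mul_le_mul_of_nonneg_left hM1 h0.le
    have hlM' := mul_le_mul_of_nonneg_left hM2 h0.le
    have hmM := mul_le_mul_of_nonneg_right hle hM0
    have heM := mul_le_mul_of_nonneg_left hM1 he0.le
    -- In both cases the norm of `y - z` is at most `M`.
    have hmax : max (p (y - z)) (q (y - z)) ≤ M := by
      rcases le_total (q (y - z)) (p (y - z)) with hle' | hle'
      · rwa [max_eq_left hle']
      · rw [max_eq_right hle'] at q1 ⊢
        nlinarith
    have heM' := mul_le_mul_of_nonneg_left hmax he0.le
    exact max_le (by nlinarith) (by nlinarith)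
  -- The cross form at `(a, b)` is a solution `y` of `H y = Ps a + Pu b`, where `H` adds the stable
  -- part of `y` and the unstable part of `f y`; by the inverse function theorem the image of `H`
  -- contains a neighbourhood of `H x`.
  let Ps : E c →L[ℝ] E c := LinearMap.toContinuousLinearMap (Es.projection Eu hcompl)
  let Pu : E c →L[ℝ] E c := LinearMap.toContinuousLinearMap (Eu.projection Es hcompl.symm)
  let H : E c → E c := fun y => Ps y + Pu (f y)
  have hH : HasStrictFDerivAt H (Ps + Pu.comp A) x :=
    Ps.hasStrictFDerivAt.add (Pu.hasStrictFDerivAt.comp x hf)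
  have hinjH : Function.Injective ((Ps + Pu.comp A : E c →L[ℝ] E c) : E c →ₗ[ℝ] E c) := by
    rw [← LinearMap.ker_eq_bot, LinearMap.ker_eq_bot']
    intro v hv
    obtain ⟨h2, h3⟩ := cross_eq_of_projection_add_eq hcompl hq0 hp0 (y := v) (z := A v) (a := 0)
      (b := 0) (by simpa [Ps, Pu] using hv)
    rw [sub_zero] at h2 h3
    have h4 := hq v
    rw [h3, mul_zero] at h4
    exact hK.eq_zero h2 (h4.antisymm (apply_nonneg q v))
  let Heq : E c ≃L[ℝ] E c := (LinearEquiv.ofInjectiveEndo _ hinjH).toContinuousLinearEquiv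
  have hH' : HasStrictFDerivAt H (Heq : E c →L[ℝ] E c) x := by
    have : (Heq : E c →L[ℝ] E c) = Ps + Pu.comp A := by
      ext v : 1
      rfl
    rwa [this]
  have hnhds : H '' Metric.ball x η ∈ 𝓝 (H x) := by
    rw [← hH'.map_nhds_eq_of_equiv]
    exact image_mem_map (Metric.ball_mem_nhds x hη)
  have hcont : Tendsto (fun w : E c × E c => Ps w.1 + Pu w.2) (𝓝 (x, f x)) (𝓝 (H x)) :=
    Continuous.tendsto (by fun_prop) _
  have hpre := hcont hnhds
  obtain ⟨ρ, hρ, hsub⟩ := Metric.mem_nhds_iff.1 hpre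
  refine ⟨p, q, mu, η, ρ, hmu0, hmu1, hη, hρ, ⟨Es, Eu, hcompl, hdim, hq0, hp0⟩, hcross, ?_⟩
  intro a ha b hb
  rw [← ball_prod_same] at hsub
  obtain ⟨y, hy, hyab⟩ := hsub (mk_mem_prod ha hb)
  exact ⟨y, hy, cross_eq_of_projection_add_eq hcompl hq0 hp0 hyab⟩

/-! ### Translates of a hyperbolic map in a small box -/

section Box

variable {c : ℕ}

/-- The open box of radius `R` around `x` for the norm `max p q`. -/
def box (p q : Seminorm ℝ (E c)) (x : E c) (R : ℝ) : Set (E c) :=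
  {y | max (p (y - x)) (q (y - x)) < R}

/-- The map `φ` fixes `x` and is given near `x` in cross form by a contraction, for the norms `p`
and `q` of the components of a splitting. -/
structure IsCrossAt (φ : E c ≃ₜ E c) (x : E c) (p q : Seminorm ℝ (E c)) (K lam η ρ : ℝ) :
    Prop where
  fixed : φ x = x
  pos : 0 < lam
  lt_one : lam < 1
  normPair : IsNormPair p q K
  contracting : CrossContracting φ p q p q lam (Metric.ball x η)
  defined : CrossDefined φ p q (Metric.ball x η) (Metric.ball x ρ) (Metric.ball (φ x) ρ)

variable {φ : E c ≃ₜ E c} {x : E c} {p q : Seminorm ℝ (E c)} {K lam η ρ R e : ℝ}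

theorem isOpen_box : IsOpen (box p q x R) :=
  isOpen_lt (((continuous_seminorm p).comp (continuous_id.sub continuous_const)).max
    ((continuous_seminorm q).comp (continuous_id.sub continuous_const))) continuous_const

theorem le_of_mem_closure_box {y : E c} (hy : y ∈ closure (box p q x R)) :
    max (p (y - x)) (q (y - x)) ≤ R := by
  have hcl : IsClosed {y | max (p (y - x)) (q (y - x)) ≤ R} :=
    isClosed_le (((continuous_seminorm p).comp (continuous_id.sub continuous_const)).max
      ((continuous_seminorm q).comp (continuous_id.sub continuous_const))) continuous_const
  exact closure_minimal (fun y (hy : _ < R) => hy.le) hcl hy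

theorem IsNormPair.dist_le (hK : IsNormPair p q K) {y : E c}
    (hy : max (p (y - x)) (q (y - x)) ≤ R) : dist y x ≤ K * R := by
  rw [dist_eq_norm]
  exact (hK.norm_le _).trans (mul_le_mul_of_nonneg_left hy (zero_le_one.trans hK.one_le))

theorem IsNormPair.box_subset_ball (hK : IsNormPair p q K) :
    box p q x R ⊆ Metric.ball x (K * R) := by
  intro y hy
  rw [Metric.mem_ball, dist_eq_norm]
  exact (hK.norm_le _).trans_lt (mul_lt_mul_of_pos_left hy (zero_lt_one.trans_le hK.one_le))

theorem IsNormPair.closedBall_subset_box (hK : IsNormPair p q K) {δ : ℝ} (hδ : K * δ < R) :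
    Metric.closedBall x δ ⊆ box p q x R := by
  intro y hy
  rw [Metric.mem_closedBall, dist_eq_norm] at hy
  exact ((hK.le_norm _).trans (mul_le_mul_of_nonneg_left hy
    (zero_le_one.trans hK.one_le))).trans_lt hδ

variable {ι : Type*} {F : ι → (E c ≃ₜ E c)} {v : ι → E c}

/-- Over every sequence there is an orbit in the box. The translations are so small that the cross
forms map a slightly smaller box into itself. -/
theorem IsCrossAt.exists_mem_maxInvariantSet (h : IsCrossAt φ x p q K lam η ρ)
    (hF : ∀ i y, F i y = φ y + v i) (hv : ∀ i, max (p (v i)) (q (v i)) ≤ e) (he : 0 ≤ e)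
    (hR : (1 + lam) * e < (1 - lam) * R) (hη : K * R < η) (hρ : K * (R + e) < ρ) (ξ : ℤ → ι) :
    ∃ y, (ξ, y) ∈ maxInvariantSet F (box p q x R) := by
  have h0 := h.pos
  have h1 := h.lt_one
  have hK0 : 0 < K := zero_lt_one.trans_le h.normPair.one_le
  -- With `R'` solving `lam * (R' + e) + e = R'`, the cross forms of all maps `F i` send the box of
  -- radius `R'` into itself.
  set R' : ℝ := (1 + lam) * e / (1 - lam) with hR'
  have hR'0 : 0 ≤ R' := div_nonneg (mul_nonneg (by linarith) he) (by linarith)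
  have hR'R : R' < R := by rw [hR', div_lt_iff₀ (by linarith)]; linarith
  have hR'e : lam * (R' + e) + e = R' := by
    have : R' * (1 - lam) = (1 + lam) * e := div_mul_cancel₀ _ (by linarith)
    linarith
  have hball : ∀ {y}, max (p (y - x)) (q (y - x)) ≤ R' → dist y x < η := fun hy =>
    ((h.normPair.dist_le hy).trans (mul_le_mul_of_nonneg_left hR'R.le hK0.le)).trans_lt hη
  have hηpos : 0 < η := (mul_nonneg hK0.le (hR'0.trans hR'R.le)).trans_lt hη
  obtain ⟨w, hw, hstep⟩ := exists_orbit_of_cross h.normPair h0 h1 hR'0 x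
    (fun n y y' => y' = F (ξ n) y)
    (by
      intro n a b ha hb
      have ha' : a ∈ Metric.ball x ρ := by
        refine ((h.normPair.dist_le ha).trans ?_).trans_lt hρ
        gcongr
        linarith
      have hb' : b - v (ξ n) ∈ Metric.ball (φ x) ρ := by
        rw [h.fixed, Metric.mem_ball, dist_eq_norm, sub_right_comm]
        have h2 := h.normPair.dist_le hb
        have h3 := (h.normPair.norm_le (v (ξ n))).trans (mul_le_mul_of_nonneg_left (hv _) hK0.le)
        rw [dist_eq_norm] at h2
        have h4 := norm_sub_le (b - x) (v (ξ n))
        have h5 := mul_le_mul_of_nonneg_left hR'R.le hK0.le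
        linarith
      obtain ⟨y, hy, hya, hyb⟩ := h.defined a ha' _ hb'
      refine ⟨y, F (ξ n) y, rfl, hya, ?_, ?_⟩
      · rw [hF, ← hyb]
        congr 1
        abel
      have h2 := h.contracting y hy x (Metric.mem_ball_self hηpos)
      rw [h.fixed, seminorm_sub_eq_of_sub_eq_zero p hya,
        seminorm_sub_eq_of_sub_eq_zero q hyb] at h2
      have h3 : q (b - v (ξ n) - x) ≤ R' + e := by
        rw [sub_right_comm]
        exact (map_sub_le_add q _ _).trans (add_le_add (max_le_iff.1 hb).2 (max_le_iff.1 (hv _)).2)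
      have h4 : max (p (a - x)) (q (b - v (ξ n) - x)) ≤ R' + e :=
        max_le ((max_le_iff.1 ha).1.trans (by linarith)) h3
      obtain ⟨h5, h6⟩ := max_le_iff.1 (h2.trans (mul_le_mul_of_nonneg_left h4 h0.le))
      refine ⟨?_, by linarith⟩
      rw [hF, add_sub_right_comm]
      have h7 := map_add_le_add p (φ y - x) (v (ξ n))
      have h8 := (max_le_iff.1 (hv (ξ n))).1
      linarith)
    (by
      rintro n y _ z _ hy - hz - rfl rfl
      rw [hF, hF, add_sub_add_right_eq_sub]
      exact h.contracting y (hball hy) z (hball hz))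
  refine ⟨w 0, (mem_maxInvariantSet _ _ _).2 fun n => subset_closure ?_⟩
  rw [skew_zpow_snd_eq F ξ w hstep]
  exact (hw n).trans_lt hR'R

theorem IsCrossAt.dist_lt_of_mem_maxInvariantSet (h : IsCrossAt φ x p q K lam η ρ)
    (hη : K * R < η) {z : (ℤ → ι) × E c} (hz : z ∈ maxInvariantSet F (box p q x R)) :
    dist z.2 x < η := by
  have h2 := (mem_maxInvariantSet _ _ _).1 hz 0
  exact (h.normPair.dist_le (le_of_mem_closure_box h2)).trans_lt hη

theorem IsCrossAt.eq_of_mem_maxInvariantSet (h : IsCrossAt φ x p q K lam η ρ)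
    (hF : ∀ i y, F i y = φ y + v i) (hη : K * R < η) (ξ : ℤ → ι) (y y' : E c)
    (hy : (ξ, y) ∈ maxInvariantSet F (box p q x R))
    (hy' : (ξ, y') ∈ maxInvariantSet F (box p q x R)) : y = y' := by
  let w : ℤ → E c := fun n => ((skew F ^ n) (ξ, y)).2
  let w' : ℤ → E c := fun n => ((skew F ^ n) (ξ, y')).2
  have hw : ∀ n, max (p (w n - x)) (q (w n - x)) ≤ R := fun n =>
    le_of_mem_closure_box ((mem_maxInvariantSet _ _ _).1 hy n)
  have hw' : ∀ n, max (p (w' n - x)) (q (w' n - x)) ≤ R := fun n =>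
    le_of_mem_closure_box ((mem_maxInvariantSet _ _ _).1 hy' n)
  have hM : ∀ s : Seminorm ℝ (E c), (∀ n, s (w n - x) ≤ R) → (∀ n, s (w' n - x) ≤ R) →
      ∀ n, s (w n - w' n) ≤ R + R := fun s h2 h3 n => by
    have := map_sub_le_add s (w n - x) (w' n - x)
    rw [sub_sub_sub_cancel_right] at this
    exact this.trans (add_le_add (h2 n) (h3 n))
  have key := eq_zero_of_cross_of_bounded (P := fun n => p (w n - w' n))
    (Q := fun n => q (w n - w' n)) h.pos h.lt_one (fun n => apply_nonneg p _)
    (fun n => apply_nonneg q _)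
    (hM p (fun n => (max_le_iff.1 (hw n)).1) fun n => (max_le_iff.1 (hw' n)).1)
    (hM q (fun n => (max_le_iff.1 (hw n)).2) fun n => (max_le_iff.1 (hw' n)).2)
    (fun n => by
      have e1 : w (n + 1) = φ (w n) + v (ξ n) := by
        simp only [w, skew_zpow_add_one_snd, hF]
      have e2 : w' (n + 1) = φ (w' n) + v (ξ n) := by
        simp only [w', skew_zpow_add_one_snd, hF]
      simp only [e1, e2, add_sub_add_right_eq_sub]
      exact h.contracting _ ((h.normPair.dist_le (hw n)).trans_lt hη) _
        ((h.normPair.dist_le (hw' n)).trans_lt hη)) 0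
  simpa [w, w'] using h.normPair.eq_of_sub key.1 key.2

/-- In the bi-Lipschitz case the norms `p` and `q` serve at all points of the invariant set, because
the maps `F i` have the same differences as `φ`. -/
theorem IsCrossAt.hasLipHyperbolicSplitting {m : ℕ} (h : IsCrossAt φ x p q K lam η ρ)
    (hpq : IsSplittingNorms p q m) (hF : ∀ i y, F i y = φ y + v i)
    (hv : ∀ i, max (p (v i)) (q (v i)) ≤ e) (hη0 : 0 < η) (hη : K * R < η / 2)
    (hρ : K * (R + e) < ρ) (he : 0 ≤ e) :
    HasLipHyperbolicSplitting F (maxInvariantSet F (box p q x R)) m := by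
  have hK0 : 0 < K := zero_lt_one.trans_le h.normPair.one_le
  have hsub : ∀ z ∈ maxInvariantSet F (box p q x R),
      Metric.ball z.2 (η / 2) ⊆ Metric.ball x η := fun z hz => by
    refine Metric.ball_subset_ball' ?_
    have := ((h.normPair.dist_le (le_of_mem_closure_box ((mem_maxInvariantSet _ _ _).1 hz 0))))
    rw [zpow_zero, Equiv.Perm.one_apply] at this
    linarith
  -- Points within `K ^ 2 * ρ'` of a point of the invariant set are at distance less than `η / 2`.
  set ρ' : ℝ := min (ρ - K * (R + e)) (η / (4 * K ^ 2))
  have hρ' : 0 < ρ' := lt_min (by linarith) (by positivity)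
  refine ⟨fun _ => p, fun _ => q, K, lam, η / 2, ρ', hK0, h.pos, h.lt_one, half_pos hη0, hρ',
    fun z hz => ⟨hpq, fun v => ⟨h.normPair.norm_le v, h.normPair.le_norm v⟩, ?_, ?_⟩⟩
  · intro a ha b hb
    rw [hF, hF, add_sub_add_right_eq_sub]
    exact h.contracting a (hsub z hz ha) b (hsub z hz hb)
  · intro a ha b hb
    have hz0 := h.normPair.dist_le (le_of_mem_closure_box ((mem_maxInvariantSet _ _ _).1 hz 0))
    have hz1 := h.normPair.dist_le (le_of_mem_closure_box ((mem_maxInvariantSet _ _ _).1 hz 1))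
    rw [zpow_zero, Equiv.Perm.one_apply] at hz0
    rw [zpow_one] at hz1
    have hz1' : dist (F (z.1 0) z.2) x ≤ K * R := hz1
    have hvK := (h.normPair.norm_le (v (z.1 0))).trans
      (mul_le_mul_of_nonneg_left (hv _) hK0.le)
    have hmin : ρ' ≤ ρ - K * (R + e) := min_le_left _ _
    rw [Metric.mem_ball] at ha hb
    have ha' : a ∈ Metric.ball x ρ := by
      have h2 := dist_triangle a z.2 x
      have h3 : 0 ≤ K * e := mul_nonneg hK0.le he
      rw [Metric.mem_ball]
      linarith
    have hb' : b - v (z.1 0) ∈ Metric.ball (φ x) ρ := by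
      rw [h.fixed, Metric.mem_ball, dist_eq_norm, sub_right_comm]
      have h2 := dist_triangle b (F (z.1 0) z.2) x
      have h4 := norm_sub_le (b - x) (v (z.1 0))
      rw [← dist_eq_norm b x] at h4
      linarith
    obtain ⟨y, hy, hya, hyb⟩ := h.defined a ha' _ hb'
    have hyb' : q (F (z.1 0) y - b) = 0 := by
      rw [hF, ← hyb]
      congr 1
      abel
    refine ⟨y, ?_, hya, hyb'⟩
    have h2 := h.contracting y hy z.2 (hsub z hz (Metric.mem_ball_self (half_pos hη0)))
    have e1 : φ y - φ z.2 = F (z.1 0) y - F (z.1 0) z.2 := by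
      rw [hF, hF, add_sub_add_right_eq_sub]
    have h3 : p (y - z.2) ≤ K * ρ' := by
      rw [seminorm_sub_eq_of_sub_eq_zero p hya]
      refine (le_max_left _ _).trans ((h.normPair.le_norm _).trans ?_)
      rw [← dist_eq_norm]
      exact mul_le_mul_of_nonneg_left ha.le hK0.le
    have h4 : q (φ y - φ z.2) ≤ K * ρ' := by
      rw [e1, seminorm_sub_eq_of_sub_eq_zero q hyb']
      refine (le_max_right _ _).trans ((h.normPair.le_norm _).trans ?_)
      rw [← dist_eq_norm]
      exact mul_le_mul_of_nonneg_left hb.le hK0.le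
    have h5 : q (y - z.2) ≤ K * ρ' := by
      refine (max_le_iff.1 h2).2.trans ((mul_le_mul_of_nonneg_left (max_le h3 h4) h.pos.le).trans ?_)
      exact mul_le_of_le_one_left (mul_nonneg hK0.le hρ'.le) h.lt_one.le
    rw [Metric.mem_ball]
    refine (h.normPair.dist_le (max_le h3 h5)).trans_lt ?_
    have h6 : ρ' ≤ η / (4 * K ^ 2) := min_le_right _ _
    rw [le_div_iff₀ (by positivity)] at h6
    nlinarith

/-- The maximal invariant set of a box, for small translates of a hyperbolic map, is hyperbolic
and transitive. -/
theorem IsCrossAt.isHyperbolicSet_and_isTransitiveOn [TopologicalSpace ι] [DiscreteTopology ι]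
    [Finite ι] [Nonempty ι] {m : ℕ} {r : ℕ∞} (h : IsCrossAt φ x p q K lam η ρ)
    (hpq : IsSplittingNorms p q m) (hF : ∀ i y, F i y = φ y + v i) (hr : ∀ i, IsCrDiffeo r (F i))
    (hv : ∀ i, max (p (v i)) (q (v i)) ≤ e) (he : 0 ≤ e) (hη0 : 0 < η)
    (hR : (1 + lam) * e < (1 - lam) * R) (hη : K * R < η / 2) (hρ : K * (R + e) < ρ) :
    IsHyperbolicSet r F (maxInvariantSet F (box p q x R)) m ∧
      IsTransitiveOn F (maxInvariantSet F (box p q x R)) := by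
  have hη' : K * R < η := hη.trans (half_lt_self hη0)
  have hbdd : Bornology.IsBounded (box p q x R) :=
    Metric.isBounded_ball.subset h.normPair.box_subset_ball
  have hcpt := isCompact_maxInvariantSet F hbdd
  refine ⟨⟨hcpt, skew_image_maxInvariantSet F _, fun hr0 => ?_, fun _ =>
    h.hasLipHyperbolicSplitting hpq hF hv hη0 hη hρ he⟩,
    isTransitiveOn_of_existsUnique F hcpt
      (h.exists_mem_maxInvariantSet hF hv he hR hη' hρ) (h.eq_of_mem_maxInvariantSet hF hη')⟩
  have hr1 : ((r : ℕ∞) : WithTop ℕ∞) ≠ 0 := by exact_mod_cast hr0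
  have hd : ∀ i, Differentiable ℝ (F i) := fun i => (hr i).1.differentiable hr1
  have hd' : ∀ i, Differentiable ℝ (F i).symm := fun i => (hr i).2.1.differentiable hr1
  refine hasHyperbolicSplitting_of_cross hd hd' hpq h.normPair h.pos h.lt_one
    (fun z hz n => skew_zpow_mem_maxInvariantSet hz n) fun z hz w => ?_
  refine le_of_crossContracting_of_hasFDerivAt (f := F (z.1 0)) Metric.isOpen_ball ?_
    (h.dist_lt_of_mem_maxInvariantSet hη' hz) (hd (z.1 0) z.2).hasFDerivAt w
  intro a ha b hb
  rw [hF, hF, add_sub_add_right_eq_sub]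
  exact h.contracting a ha b hb

end Box

/-! ### Translated diffeomorphisms and the covering property -/

section Translates

variable {c : ℕ}

theorem exists_local_lipschitz {r : ℕ∞} {f : E c → E c} (hf : ContDiff ℝ r f)
    (hf0 : r = 0 → ∃ K : NNReal, LipschitzWith K f) (x : E c) :
    ∃ L ρ : ℝ, 1 ≤ L ∧ 0 < ρ ∧ ∀ y ∈ Metric.ball x ρ, dist (f y) (f x) ≤ L * dist y x := by
  obtain ⟨K, t, ht, hK⟩ : ∃ K : NNReal, ∃ t ∈ 𝓝 x, LipschitzOnWith K f t := by
    rcases eq_or_ne r 0 with h | h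
    · obtain ⟨K, hK⟩ := hf0 h
      exact ⟨K, univ, univ_mem, hK.lipschitzOnWith⟩
    · have h1 : (1 : WithTop ℕ∞) ≤ r := by exact_mod_cast Order.one_le_iff_ne_zero.2 h
      exact (hf.of_le h1).contDiffAt.exists_lipschitzOnWith
  obtain ⟨ρ, hρ, hsub⟩ := Metric.mem_nhds_iff.1 ht
  refine ⟨max 1 K, ρ, le_max_left _ _, hρ, fun y hy => ?_⟩
  exact (hK.dist_le_mul _ (hsub hy) _ (mem_of_mem_nhds ht)).trans
    (mul_le_mul_of_nonneg_right (le_max_right _ _) dist_nonneg)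

/-- The map `φ` followed by the translation by `v`. -/
def translate (φ : E c ≃ₜ E c) (v : E c) : E c ≃ₜ E c := φ.trans (Homeomorph.addRight v)

theorem translate_apply (φ : E c ≃ₜ E c) (v y : E c) : translate φ v y = φ y + v := rfl

theorem translate_symm_apply (φ : E c ≃ₜ E c) (v y : E c) :
    (translate φ v).symm y = φ.symm (y - v) := by
  rw [Homeomorph.symm_apply_eq, translate_apply, φ.apply_symm_apply, sub_add_cancel]

theorem translate_zero (φ : E c ≃ₜ E c) : translate φ 0 = φ :=
  Homeomorph.ext fun y => add_zero (φ y)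

theorem IsCrDiffeo.translate {r : ℕ∞} {φ : E c ≃ₜ E c} (h : IsCrDiffeo r φ) (v : E c) :
    IsCrDiffeo r (translate φ v) := by
  have e1 : ⇑(Blending.translate φ v) = fun y => φ y + v := rfl
  have e2 : ⇑(Blending.translate φ v).symm = fun y => φ.symm (y - v) :=
    funext (translate_symm_apply φ v)
  refine ⟨?_, ?_, fun hr => ?_⟩
  · rw [e1]
    exact h.1.add contDiff_const
  · rw [e2]
    exact h.2.1.comp (contDiff_id.sub contDiff_const)
  · obtain ⟨K, h1, h2⟩ := h.2.2 hr
    refine ⟨K, LipschitzWith.of_dist_le_mul fun y z => ?_,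
      LipschitzWith.of_dist_le_mul fun y z => ?_⟩
    · rw [e1, dist_add_right]
      exact h1.dist_le_mul y z
    · rw [e2]
      simpa using h2.dist_le_mul (y - v) (z - v)

theorem isArc_translate {r : ℕ∞} {φ : E c ≃ₜ E c} (h : IsCrDiffeo r φ) {v : ℝ → E c}
    (hv : Continuous v) : IsArc r fun ε => translate φ (v ε) := by
  refine ⟨fun ε _ => h.translate _, fun j hj => Continuous.continuousOn ?_⟩
  have hj' : (j : WithTop ℕ∞) ≤ r := by exact_mod_cast hj
  rcases j with - | j
  · simp only [iteratedFDeriv_zero_eq_comp, Function.comp_apply, translate_apply]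
    exact (LinearIsometryEquiv.continuous _).comp
      ((φ.continuous.comp continuous_snd).add (hv.comp continuous_fst))
  · have h2 : ∀ e : ℝ × E c, iteratedFDeriv ℝ (j + 1) (translate φ (v e.1)) e.2 =
        iteratedFDeriv ℝ (j + 1) φ e.2 := by
      intro e
      have h3 : ⇑(translate φ (v e.1)) = ⇑φ + fun _ => v e.1 := rfl
      rw [h3, iteratedFDeriv_add_apply (h.1.of_le hj').contDiffAt contDiffAt_const,
        iteratedFDeriv_const_of_ne (Nat.succ_ne_zero j)]
      exact add_zero _
    simp only [h2]
    exact (h.1.continuous_iteratedFDeriv hj').comp continuous_snd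

theorem isPHS_translate {θ : ℝ} {φ : E c ≃ₜ E c} {ι ι' : Type*} [Nonempty ι]
    (h : IsPHS θ fun _ : ι => φ) (v : ι' → E c) : IsPHS θ fun i => translate φ (v i) := by
  obtain ⟨γ, γ', h1, h2, h3, h4, h5⟩ := h
  refine ⟨γ, γ', h1, h2, h3, h4, fun i y z => ?_⟩
  simpa only [translate_apply, dist_add_right] using h5 (Classical.arbitrary ι) y z

/-- A finite net of a ball of radius `L`, together with the opposite vectors and starting with
the zero vector. -/
theorem exists_finite_net (c : ℕ) {L : ℝ} (hL : 1 ≤ L) :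
    ∃ k : ℕ, ∃ w : Fin (k + 1) → E c, 1 ≤ k ∧ w 0 = 0 ∧
      (∀ u, ‖u‖ ≤ 1 → ∃ i, ‖u - w i‖ < L⁻¹) ∧ ∀ u, ‖u‖ ≤ L → ∃ i, ‖u + w i‖ < 1 := by
  have hL0 : 0 < L := by linarith
  obtain ⟨t, -, htf, ht⟩ := (isCompact_closedBall (0 : E c) L).finite_cover_balls (inv_pos.2 hL0)
  have hnet : ∀ u : E c, ‖u‖ ≤ L → ∃ w ∈ t, ‖u - w‖ < L⁻¹ := fun u hu => by
    simpa [dist_eq_norm] using ht (mem_closedBall_zero_iff.2 hu)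
  have : Finite ↥(t ∪ -t) := (htf.union htf.neg).to_subtype
  obtain ⟨n, ⟨eqv⟩⟩ := Finite.exists_equiv_fin ↥(t ∪ -t)
  obtain ⟨w₀, hw₀, -⟩ := hnet 0 (by simpa using hL0.le)
  have hn : 1 ≤ n := Fin.pos (eqv ⟨w₀, Or.inl hw₀⟩)
  have hidx : ∀ w ∈ t ∪ -t, ∃ i : Fin (n + 1),
      (Fin.cons 0 fun j => (eqv.symm j : E c) : Fin (n + 1) → E c) i = w := fun w hw =>
    ⟨(eqv ⟨w, hw⟩).succ, by simp⟩
  refine ⟨n, Fin.cons 0 fun j => (eqv.symm j : E c), hn, rfl, fun u hu => ?_, fun u hu => ?_⟩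
  · obtain ⟨w, hw, hd⟩ := hnet u (hu.trans hL)
    obtain ⟨i, hi⟩ := hidx w (Or.inl hw)
    exact ⟨i, by rwa [hi]⟩
  · obtain ⟨w, hw, hd⟩ := hnet u hu
    obtain ⟨i, hi⟩ := hidx (-w) (Or.inr (by simpa using hw))
    refine ⟨i, ?_⟩
    rw [hi, ← sub_eq_add_neg]
    exact hd.trans_le (inv_le_one_of_one_le₀ hL)

variable {φ : E c ≃ₜ E c} {x : E c} {L ρ δ : ℝ} {ι : Type*} {w : ι → E c}

/-- The image of `ball x δ` contains `ball x (δ / L)`, finitely many translates of which cover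
`closedBall x δ`. -/
theorem closedBall_subset_iUnion_image (hL : 1 ≤ L) (hδ : 0 < δ) (hδρ : δ < ρ)
    (hφ : ∀ y ∈ Metric.ball x ρ, dist (φ.symm y) x ≤ L * dist y x)
    (hw : ∀ u, ‖u‖ ≤ 1 → ∃ i, ‖u - w i‖ < L⁻¹) :
    Metric.closedBall x δ ⊆ ⋃ i, translate φ (δ • w i) '' Metric.ball x δ := by
  intro y hy
  have hL0 : 0 < L := by linarith
  obtain ⟨i, hi⟩ := hw (δ⁻¹ • (y - x)) (by
    rw [norm_smul, norm_inv, Real.norm_of_nonneg hδ.le, inv_mul_le_iff₀ hδ, mul_one,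
      ← dist_eq_norm]
    exact hy)
  have h1 : dist (y - δ • w i) x < δ * L⁻¹ := by
    have h2 : y - δ • w i - x = δ • (δ⁻¹ • (y - x) - w i) := by
      rw [smul_sub, smul_inv_smul₀ hδ.ne', sub_right_comm]
    rw [dist_eq_norm, h2, norm_smul, Real.norm_of_nonneg hδ.le]
    exact mul_lt_mul_of_pos_left hi hδ
  have h3 : δ * L⁻¹ ≤ δ := mul_le_of_le_one_right hδ.le (inv_le_one_of_one_le₀ hL)
  refine mem_iUnion.2 ⟨i, φ.symm (y - δ • w i), ?_, ?_⟩
  · rw [Metric.mem_ball]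
    calc _ ≤ _ := hφ _ (by rw [Metric.mem_ball]; linarith)
      _ < L * (δ * L⁻¹) := mul_lt_mul_of_pos_left h1 hL0
      _ = δ := by field_simp
  · rw [translate_apply, φ.apply_symm_apply, sub_add_cancel]

/-- The image of `closedBall x δ` is contained in `closedBall x (L * δ)`, which is covered by
finitely many translates of `ball x δ`. -/
theorem closedBall_subset_iUnion_symm_image (hδ : 0 < δ) (hL : 1 ≤ L) (hδρ : δ < ρ)
    (hφ : ∀ y ∈ Metric.ball x ρ, dist (φ y) x ≤ L * dist y x)
    (hw : ∀ u, ‖u‖ ≤ L → ∃ i, ‖u + w i‖ < 1) :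
    Metric.closedBall x δ ⊆ ⋃ i, (translate φ (δ • w i)).symm '' Metric.ball x δ := by
  intro y hy
  have hy' : dist y x ≤ δ := hy
  obtain ⟨i, hi⟩ := hw (δ⁻¹ • (φ y - x)) (by
    rw [norm_smul, norm_inv, Real.norm_of_nonneg hδ.le, inv_mul_le_iff₀ hδ, ← dist_eq_norm,
      mul_comm δ]
    exact (hφ y (hy'.trans_lt hδρ)).trans (mul_le_mul_of_nonneg_left hy' (by linarith)))
  refine mem_iUnion.2 ⟨i, translate φ (δ • w i) y, ?_, Homeomorph.symm_apply_apply _ _⟩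
  have h2 : φ y + δ • w i - x = δ • (δ⁻¹ • (φ y - x) + w i) := by
    rw [smul_add, smul_inv_smul₀ hδ.ne', sub_add_eq_add_sub]
  rw [Metric.mem_ball, translate_apply, dist_eq_norm, h2, norm_smul, Real.norm_of_nonneg hδ.le]
  exact mul_lt_of_lt_one_right hδ hi

theorem IsHyperbolicFixedPoint.isLipHyperbolicAt {r : ℕ∞} {m : ℕ} (hφ : IsCrDiffeo r φ)
    (hx : IsHyperbolicFixedPoint r φ x m) : IsLipHyperbolicAt φ x m := by
  rcases eq_or_ne r 0 with hr | hr
  · exact hx.2.2 hr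
  · have hr1 : ((r : ℕ∞) : WithTop ℕ∞) ≠ 0 := by exact_mod_cast hr
    exact isLipHyperbolicAt_of_hasStrictFDerivAt
      (hφ.1.contDiffAt.hasStrictFDerivAt hr1) (hx.2.1 hr)

end Translates

end Blending

theorem mainTheorem6 {c : ℕ} (hc : 1 ≤ c) (r : ℕ∞) (φ : Blending.E c ≃ₜ Blending.E c)
    (hφ : Blending.IsCrDiffeo r φ) (x : Blending.E c) (m : ℕ)
    (hx : Blending.IsHyperbolicFixedPoint r φ x m) :
    ∃ k : ℕ, 2 ≤ k ∧
    ∃ (f : Fin k → ℝ → (Blending.E c ≃ₜ Blending.E c)) (v : Fin k → ℝ → Blending.E c)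
      (D : ℝ → Set (Blending.E c)) (δ : ℝ → ℝ),
      -- the maps `f i ε` form arcs starting at `φ`
      (∀ i, Blending.IsArc r (f i)) ∧
      (∀ i, f i 0 = φ) ∧
      -- `f i ε` is `φ` followed by the translation by `v i ε`, and the first map is `φ` itself
      (∀ i, ContinuousOn (v i) (Set.Ici 0)) ∧
      (∀ i, ∀ ε, 0 ≤ ε → ∀ y, f i ε y = φ y + v i ε) ∧
      (∀ i : Fin k, (i : ℕ) = 0 → ∀ ε, 0 ≤ ε → f i ε = φ) ∧
      -- the maps stay in the class of partially hyperbolic skew-products if `φ` is in it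
      (∀ θ : ℝ, 0 < θ → θ < 1 → Blending.IsPHS θ (fun _ : Fin k => φ) →
        ∀ ε, 0 ≤ ε → Blending.IsPHS θ (fun i => f i ε)) ∧
      (∀ ε, 0 ≤ ε → IsOpen (D ε) ∧ Bornology.IsBounded (D ε)) ∧
      ∀ ε, 0 < ε →
        0 < δ ε ∧
        Metric.ball x (δ ε) ⊆ D ε ∧
        D ε ⊆ Metric.ball x (2 * ε) ∧
        -- attracting fixed point
        (m = c → Blending.IsCsBlendingRegion r (fun i => f i ε) (Metric.ball x (δ ε)) (D ε) m) ∧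
        -- repelling fixed point
        (m = 0 → Blending.IsCuBlendingRegion r (fun i => f i ε) (Metric.ball x (δ ε)) (D ε) m) ∧
        -- saddle
        (0 < m → m < c →
          Blending.IsDoubleBlendingRegion r (fun i => f i ε) (Metric.ball x (δ ε)) (D ε) m) := by
  obtain ⟨p, q, lam, η, ρ, h0, h1, hη, hρ, hpq, hcon, hdef⟩ := hx.isLipHyperbolicAt hφ
  obtain ⟨K, hK⟩ : ∃ K, Blending.IsNormPair p q K := by
    obtain ⟨Es, Eu, hcompl, -, hEs, hEu⟩ := hpq
    exact Blending.exists_isNormPair hcompl hEs hEu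
  have hcr : Blending.IsCrossAt φ x p q K lam η ρ := ⟨hx.1, h0, h1, hK, hcon, hdef⟩
  have hK0 : 0 < K := zero_lt_one.trans_le hK.one_le
  have hx' : φ.symm x = x := by rw [Homeomorph.symm_apply_eq, hx.1]
  -- Local Lipschitz constants of `φ` and of its inverse.
  obtain ⟨L₁, ρ₁, hL₁, hρ₁, hlip₁⟩ := Blending.exists_local_lipschitz hφ.1
    (fun hr => (hφ.2.2 hr).imp fun _ h => h.1) x
  obtain ⟨L₂, ρ₂, hL₂, hρ₂, hlip₂⟩ := Blending.exists_local_lipschitz hφ.2.1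
    (fun hr => (hφ.2.2 hr).imp fun _ h => h.2) x
  rw [hx.1] at hlip₁
  rw [hx'] at hlip₂
  have hL : 1 ≤ max L₁ L₂ := hL₁.trans (le_max_left _ _)
  obtain ⟨k, w, hk, hw0, hws, hwu⟩ := Blending.exists_finite_net c hL
  obtain ⟨M, hM⟩ : ∃ M, ∀ i, ‖w i‖ ≤ M := by
    obtain ⟨M, hM⟩ := (Set.finite_range fun i => ‖w i‖).bddAbove
    exact ⟨M, fun i => hM ⟨i, rfl⟩⟩
  have hM0 : 0 ≤ M := (norm_nonneg _).trans (hM 0)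
  -- The box has radius `R ε`, so that it lies in a ball of radius `min ε ε₀`; the ball to be
  -- covered and the translations are smaller by the factor `s`, a small fraction of the gap
  -- `1 - lam`.
  set ε₀ : ℝ := min (min η ρ) (min ρ₁ ρ₂) / 4 with hε₀
  have hε₀0 : 0 < ε₀ := by positivity
  have hmin1 : min (min η ρ) (min ρ₁ ρ₂) ≤ min η ρ := min_le_left _ _
  have hmin2 : min (min η ρ) (min ρ₁ ρ₂) ≤ min ρ₁ ρ₂ := min_le_right _ _
  have hε₀η : 4 * ε₀ ≤ η := by linarith [min_le_left η ρ]
  have hε₀ρ : 4 * ε₀ ≤ ρ := by linarith [min_le_right η ρ]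
  have hε₀1 : 4 * ε₀ ≤ ρ₁ := by linarith [min_le_left ρ₁ ρ₂]
  have hε₀2 : 4 * ε₀ ≤ ρ₂ := by linarith [min_le_right ρ₁ ρ₂]
  set s : ℝ := (1 - lam) / (4 * K * (M + 1)) with hs
  have hs0 : 0 < s := div_pos (by linarith) (by positivity)
  have hsK : K * (s * (M + 1)) = (1 - lam) / 4 := by
    rw [hs]
    field_simp
  let R : ℝ → ℝ := fun ε => min ε ε₀ / K
  have hRc : Continuous R := by fun_prop
  have hKR : ∀ ε, K * R ε = min ε ε₀ := fun ε => mul_div_cancel₀ _ hK0.ne'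
  refine ⟨k + 1, by omega, fun i ε => Blending.translate φ ((s * R ε) • w i),
    fun i ε => (s * R ε) • w i, fun ε => Blending.box p q x (R ε), fun ε => s * R ε,
    fun i => Blending.isArc_translate hφ (by fun_prop), fun i => ?_,
    fun i => Continuous.continuousOn (by fun_prop), fun i ε _ y => rfl, fun i hi ε _ => ?_,
    fun θ _ _ h ε _ => Blending.isPHS_translate h _,
    fun ε _ => ⟨Blending.isOpen_box, Metric.isBounded_ball.subset hK.box_subset_ball⟩,
    fun ε hε => ?_⟩
  · simp [R, hε₀0.le, Blending.translate_zero]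
  · have : i = 0 := Fin.ext hi
    subst this
    simp only [hw0, smul_zero, Blending.translate_zero]
  have hR0 : 0 < R ε := div_pos (lt_min hε hε₀0) hK0
  have hδ : 0 < s * R ε := mul_pos hs0 hR0
  have hRε : K * R ε ≤ ε := (hKR ε).trans_le (min_le_left _ _)
  have hRε₀ : K * R ε ≤ ε₀ := (hKR ε).trans_le (min_le_right _ _)
  have hKM : K * (s * R ε) * (M + 1) = (1 - lam) / 4 * R ε := by rw [← hsK]; ring
  have hRK : R ε ≤ K * R ε := le_mul_of_one_le_left hR0.le hK.one_le
  have hKδ0 : 0 < K * (s * R ε) := mul_pos hK0 hδ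
  have hKδM : 0 ≤ K * (s * R ε) * M := mul_nonneg hKδ0.le hM0
  have hlR : (1 - lam) / 4 * R ε < R ε / 4 := by nlinarith
  have hKδ : K * (s * R ε) < R ε := by linarith
  have hδK : s * R ε ≤ K * (s * R ε) := le_mul_of_one_le_left hδ.le hK.one_le
  have he : K * (s * R ε) * M < (1 - lam) / 4 * R ε := by linarith
  have hv : ∀ i, max (p ((s * R ε) • w i)) (q ((s * R ε) • w i)) ≤ K * (s * R ε) * M := by
    intro i
    refine (hK.le_norm _).trans ?_
    rw [norm_smul, Real.norm_of_nonneg hδ.le, ← mul_assoc]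
    exact mul_le_mul_of_nonneg_left (hM i) hKδ0.le
  have hsub : Metric.closedBall x (s * R ε) ⊆ Blending.box p q x (R ε) :=
    hK.closedBall_subset_box hKδ
  have hpre : Blending.IsPreBlending r (fun i => Blending.translate φ ((s * R ε) • w i))
      (Metric.ball x (s * R ε)) (Blending.box p q x (R ε)) m :=
    ⟨Metric.isOpen_ball, Metric.isBounded_ball, Blending.isOpen_box,
      Metric.isBounded_ball.subset hK.box_subset_ball,
      Metric.closure_ball_subset_closedBall.trans hsub,
      hcr.isHyperbolicSet_and_isTransitiveOn hpq (fun i y => rfl) (fun i => hφ.translate _) hv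
        hKδM hη (by nlinarith) (by linarith) (by
          have : K * (K * (s * R ε) * M) ≤ K * R ε := mul_le_mul_of_nonneg_left (by linarith) hK0.le
          linarith)⟩
  -- Both covering properties hold, whatever the index `m`.
  have hcs : closure (Metric.ball x (s * R ε)) ⊆
      ⋃ i, Blending.translate φ ((s * R ε) • w i) '' Metric.ball x (s * R ε) :=
    Metric.closure_ball_subset_closedBall.trans
      (Blending.closedBall_subset_iUnion_image hL hδ (by linarith) (fun y hy =>
        (hlip₂ y hy).trans (mul_le_mul_of_nonneg_right (le_max_right _ _) dist_nonneg)) hws)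
  have hcu : closure (Metric.ball x (s * R ε)) ⊆
      ⋃ i, (Blending.translate φ ((s * R ε) • w i)).symm '' Metric.ball x (s * R ε) :=
    Metric.closure_ball_subset_closedBall.trans
      (Blending.closedBall_subset_iUnion_symm_image hδ hL (by linarith) (fun y hy =>
        (hlip₁ y hy).trans (mul_le_mul_of_nonneg_right (le_max_left _ _) dist_nonneg)) hwu)
  exact ⟨hδ, Metric.ball_subset_closedBall.trans hsub,
    hK.box_subset_ball.trans (Metric.ball_subset_ball (by linarith)),
    fun hm => ⟨hpre, hcs, by omega⟩, fun hm => ⟨hpre, hcu, by omega⟩,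
    fun hm hm' => ⟨⟨hpre, hcs, hm⟩, hpre, hcu, by omega⟩⟩
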